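/- Let $d\ge 1$ and let Alice and Bob each hold a system $\mathbb C^{d+1}$ with orthonormal basis $|0\rangle,\dots,|d\rangle$ (so each holds $n=\log(d+1)$ qubits). Put $|\Phi\rangle=\frac1{\sqrt d}(|11\rangle+\cdots+|dd\rangle)$, $P=|00\rangle\langle00|+|\Phi\rangle\langle\Phi|$ and $$U=|00\rangle\langle\Phi|+|\Phi\rangle\langle 00|+I-P .$$ A protocol with $c$ bits of communication that uses a shared state $\chi$ consists of free local quantum operations (with arbitrary finite-dimensional ancillas) and the exchange of $c$ classical bits in total, in both directions and with any number of rounds, and starts with the input on $AB$ together with $\chi$ shared by the two parties. It simulates $U$ to error $\epsilon$ if the channel $W$ on $AB$ that it implements satisfies $\|W-U(\cdot)U^\dagger\|_\diamond\le\epsilon$, where $\|S\|_\diamond=\sup_{\psi\ge0,\ \mathrm{tr}\,\psi=1}\|(\mathcal I\otimes S)(\psi)\|_1$. Let $C^{E}_\epsilon(U)$ be the least number of bits of a protocol that simulates $U$ to error $\epsilon$ when $\chi$ consists of any finite number of EPR pairs, and let $C^{\mathrm{ent}}_\epsilon(U)$ be the least number of bits when $\chi$ may be any bipartite entangled state. All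 logarithms are to base $2$. (i) Let $\epsilon\ge0$ and $\delta=(4\epsilon)^{1/8}$ with $\delta<\frac12$. Then $$C^{E}_\epsilon(U)\ \ge\ 2\log d-1+\log\bigl((1-2\delta)(1-\delta)^2\bigr).$$ In particular $C^{E}_\epsilon(U)\ge 2n-3+\log\bigl((1-2\delta)(1-\delta)^2\bigr)$, so assistance by EPR pairs costs at least roughly $2n$ bits. (ii) In contrast, for every $0<\epsilon\le1$, a suitable entangled state makes $O(\log\frac1\epsilon+1)$ bits suffice, independently of $d$: $$C^{\mathrm{ent}}_\epsilon(U)\ \le\ 24+16\log\tfrac1\epsilon .$$ -/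

import Mathlib

open scoped Matrix Kronecker ENNReal ComplexOrder

noncomputable section

namespace NonlocalSim

/-- Linear maps taking operators on `ℂ^X` to operators on `ℂ^Y`. -/
abbrev Superop (X Y : Type) : Type := Matrix X X ℂ →ₗ[ℂ] Matrix Y Y ℂ

/-- The completely positive map `ρ ↦ ∑ i, K i * ρ * (K i)ᴴ` with Kraus operators `K i`. -/
def krausMap {ι X Y : Type} [Fintype ι] [Fintype X] (K : ι → Matrix Y X ℂ) : Superop X Y where
  toFun ρ := ∑ i, K i * ρ * (K i)ᴴ
  map_add' ρ σ := by
    simp only [Matrix.mul_add, Matrix.add_mul, Finset.sum_add_distrib]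
  map_smul' z ρ := by
    simp only [Matrix.mul_smul, Matrix.smul_mul, Finset.smul_sum, RingHom.id_apply]

/-- The channel `ρ ↦ U * ρ * Uᴴ`. -/
def conjChannel {X : Type} [Fintype X] (U : Matrix X X ℂ) : Superop X X :=
  krausMap (fun _ : Unit => U)

/-- The trace norm: the sum of the singular values of `M`. -/
def traceNorm {X : Type} [Fintype X] [DecidableEq X] (M : Matrix X X ℂ) : ℝ :=
  ∑ i, Real.sqrt ((Matrix.isHermitian_conjTranspose_mul_self M).eigenvalues i)

/-- The map `id_R ⊗ S`, where the reference system is `ℂ^R`: `S` acts on every block. -/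
def extend {X Y : Type} (R : Type) (S : Superop X Y) (ψ : Matrix (R × X) (R × X) ℂ) :
    Matrix (R × Y) (R × Y) ℂ :=
  Matrix.of fun p q => S (Matrix.of fun x x' => ψ (p.1, x) (q.1, x')) p.2 q.2

/-- The diamond norm: the supremum of `‖(id ⊗ S) ψ‖₁` over all density operators `ψ` on the input
together with a reference system of arbitrary finite dimension. -/
def diamondNorm {X Y : Type} [Fintype X] [Fintype Y] [DecidableEq Y] (S : Superop X Y) : ℝ≥0∞ :=
  ⨆ (n : ℕ) (ψ : Matrix (Fin n × X) (Fin n × X) ℂ) (_ : ψ.PosSemidef) (_ : ψ.trace = 1),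
    ENNReal.ofReal (traceNorm (extend (Fin n) S ψ))

/-- `IsLOCC A' B' c A B N`: the two parties, holding systems `A` and `B`, can implement the map `N`
(with outputs `A'` and `B'`) by local operations and `c` bits of classical communication in total.
One of the parties performs a local quantum instrument with outcome in `{0, 1}`, keeps the
post-measurement system and sends the outcome to the other; everything done afterwards, including
who sends next (see the two branches `N false`, `N true`), may depend on the bits already sent.
Local operations without communication are free. -/
inductive IsLOCC (A' B' : Type) [Fintype A'] [Fintype B'] :
    ℕ → ∀ (A B : Type) [Fintype A] [Fintype B] [DecidableEq A] [DecidableEq B],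
      Superop (A × B) (A' × B') → Prop
  /-- No further communication: each party applies a local quantum channel. -/
  | finish {A B : Type} [Fintype A] [Fintype B] [DecidableEq A] [DecidableEq B] {r s : ℕ}
      (K : Fin r → Matrix A' A ℂ) (L : Fin s → Matrix B' B ℂ)
      (hK : ∑ i, (K i)ᴴ * K i = 1) (hL : ∑ j, (L j)ᴴ * L j = 1) :
      IsLOCC A' B' 0 A B (krausMap (fun ij : Fin r × Fin s => K ij.1 ⊗ₖ L ij.2))
  /-- Alice applies an instrument and sends its one-bit outcome to Bob. -/
  | aliceSends {c : ℕ} {A B A₁ : Type} [Fintype A] [Fintype B] [Fintype A₁]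
      [DecidableEq A] [DecidableEq B] [DecidableEq A₁] {r : ℕ}
      (K : Bool → Fin r → Matrix A₁ A ℂ)
      (hK : ∑ b, ∑ i, (K b i)ᴴ * K b i = 1)
      (N : Bool → Superop (A₁ × B) (A' × B'))
      (hN : ∀ b, IsLOCC A' B' c A₁ B (N b)) :
      IsLOCC A' B' (c + 1) A B
        (∑ b, N b ∘ₗ krausMap (fun i => K b i ⊗ₖ (1 : Matrix B B ℂ)))
  /-- Bob applies an instrument and sends its one-bit outcome to Alice. -/
  | bobSends {c : ℕ} {A B B₁ : Type} [Fintype A] [Fintype B] [Fintype B₁]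
      [DecidableEq A] [DecidableEq B] [DecidableEq B₁] {r : ℕ}
      (L : Bool → Fin r → Matrix B₁ B ℂ)
      (hL : ∑ b, ∑ j, (L b j)ᴴ * L b j = 1)
      (N : Bool → Superop (A × B₁) (A' × B'))
      (hN : ∀ b, IsLOCC A' B' c A B₁ (N b)) :
      IsLOCC A' B' (c + 1) A B
        (∑ b, N b ∘ₗ krausMap (fun j => (1 : Matrix A A ℂ) ⊗ₖ L b j))

/-- `ρ_{AB} ↦ ρ_{AB} ⊗ |χ⟩⟨χ|_{CD}`, where Alice receives the share `C` and Bob the share `D`. -/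
def adjoinState {C D : Type} (A B : Type) (χ : C × D → ℂ) :
    Superop (A × B) ((A × C) × (B × D)) where
  toFun ρ := Matrix.of fun p q =>
    ρ (p.1.1, p.2.1) (q.1.1, q.2.1) * (χ (p.1.2, p.2.2) * star (χ (q.1.2, q.2.2)))
  map_add' ρ σ := by
    ext p q
    simp [add_mul]
  map_smul' z ρ := by
    ext p q
    simp [mul_assoc]

/-- With the shared pure state `χ`, free local operations and `c` bits of classical communication
(in both directions together), the channel of `U` is simulated up to error `ε` in diamond norm. -/
def Simulates {A B C D : Type} [Fintype A] [Fintype B] [Fintype C] [Fintype D]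
    [DecidableEq A] [DecidableEq B] [DecidableEq C] [DecidableEq D]
    (χ : C × D → ℂ) (c : ℕ) (U : Matrix (A × B) (A × B) ℂ) (ε : ℝ) : Prop :=
  ∃ N : Superop ((A × C) × (B × D)) (A × B),
    IsLOCC A B c (A × C) (B × D) N ∧
      diamondNorm (N ∘ₗ adjoinState A B χ - conjChannel U) ≤ ENNReal.ofReal ε

/-- The EPR pair `(|00⟩ + |11⟩) / √2`. -/
def eprPair (p : Fin 2 × Fin 2) : ℂ := if p.1 = p.2 then ((1 / Real.sqrt 2 : ℝ) : ℂ) else 0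

/-- `k` EPR pairs: the `k`-fold tensor power of `eprPair`, Alice holding the first and Bob the
second qubit of every pair. -/
def eprPairs (k : ℕ) (p : (Fin k → Fin 2) × (Fin k → Fin 2)) : ℂ :=
  ∏ i, eprPair (p.1 i, p.2 i)

/-- The classical communication cost of simulating `U` up to error `ε` given unlimited EPR pairs:
the least number of bits over all protocols that start with any number of EPR pairs. -/
def simCostEPR {A B : Type} [Fintype A] [Fintype B] [DecidableEq A] [DecidableEq B]
    (U : Matrix (A × B) (A × B) ℂ) (ε : ℝ) : EReal :=
  ⨅ (c : ℕ) (_ : ∃ k : ℕ, Simulates (eprPairs k) c U ε), ((c : ℝ) : EReal)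

/-- The classical communication cost of simulating `U` up to error `ε` when the two parties may
start with a bipartite entangled state of their choice. -/
def simCostEnt {A B : Type} [Fintype A] [Fintype B] [DecidableEq A] [DecidableEq B]
    (U : Matrix (A × B) (A × B) ℂ) (ε : ℝ) : EReal :=
  ⨅ (c : ℕ) (_ : ∃ (C D : Type) (_ : Fintype C) (_ : Fintype D) (_ : DecidableEq C)
      (_ : DecidableEq D) (χ : C × D → ℂ), ∑ p, ‖χ p‖ ^ 2 = 1 ∧ Simulates χ c U ε), ((c : ℝ) : EReal)

/-- The vector `|00⟩` of `ℂ^(d+1) ⊗ ℂ^(d+1)`. -/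
def ketZero (d : ℕ) : Fin (d + 1) × Fin (d + 1) → ℂ := Pi.single (0, 0) 1

/-- The vector `|Φ⟩ = (|11⟩ + ⋯ + |dd⟩) / √d` of `ℂ^(d+1) ⊗ ℂ^(d+1)`. -/
def ketPhi (d : ℕ) (p : Fin (d + 1) × Fin (d + 1)) : ℂ :=
  if p.1 = p.2 ∧ p.1 ≠ 0 then ((1 / Real.sqrt d : ℝ) : ℂ) else 0

/-- The operator `|v⟩⟨w|`. -/
def ketBra {X : Type} (v w : X → ℂ) : Matrix X X ℂ := Matrix.vecMulVec v (star w)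

/-- The gate `U = |00⟩⟨Φ| + |Φ⟩⟨00| + I - P`, where `P = |00⟩⟨00| + |Φ⟩⟨Φ|`. -/
def gate (d : ℕ) : Matrix (Fin (d + 1) × Fin (d + 1)) (Fin (d + 1) × Fin (d + 1)) ℂ :=
  ketBra (ketZero d) (ketPhi d) + ketBra (ketPhi d) (ketZero d)
    + (1 - (ketBra (ketZero d) (ketZero d) + ketBra (ketPhi d) (ketPhi d)))

end NonlocalSim

end

noncomputable section

namespace NonlocalSim

/-! Lower bound: coherence between branches of very different entanglement is expensive. The gate is
tested on `(|Φ⟩_R|00⟩ + |00⟩_R|Φ⟩)/√2`, where each party also holds its half of the reference `R`.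
Across the cut between the parties this state is maximally entangled of rank `2d`, and it remains
maximally entangled when EPR pairs are adjoined. The gate turns it into `(|00⟩_R|00⟩ +
|Φ⟩_R|Φ⟩)/√2`, a superposition of a product state and a maximally entangled state of rank `d²`.

By `IsLOCC.hasProductKraus`, a `c`-bit protocol is a sum over `2^c` transcripts of completely
positive maps with product Kraus operators. For one transcript, `norm_overlap_sq_le` bounds the
coherence of the two branches by `√Q_m / d`, where `Q_m` is the weight of the output in the second
block. The reason is that the amplitudes factor through a space whose dimension is the Schmidt rank
of the resource, and the flat Schmidt coefficients cancel this rank exactly. Cauchy-Schwarz over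
transcripts gives `S² ≤ 2^c q / d²` for the total coherence `S` and the total weight `q`
(`Simulates.exists_weights`). Fidelity near 1 with the target forces `S ≈ 1/2` and `q ≈ 1/2`, so
`2^c` is at least about `d²/2` (`weight_bound`).

Upper bound: the gate is the reflection `1 - 2|v⟩⟨v|` with `v = (|00⟩ - |Φ⟩)/√2`. The parties share
`N - 1` copies of `v` and a maximally entangled register indexed by a cyclic group of order `N`. On
the input together with the copies they implement `1 - (2/N) ∑ g, τ g`, where `τ` is the cyclic
shift of the `N` subsystems. It sends `v^{⊗N}` to its negative. If `p ⊥ v`, the shifts of `p ⊗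
v^{⊗(N-1)}` are orthogonal, so their average has norm only `‖p‖/√N`. Hence the error is `2/√N` on
vectors (`sum_sqNorm_reflect_sub_le`), whatever `d` is. The controlled shifts cost one `N`-valued
message in each direction (`exists_isLOCC_reflectKraus`). -/

/-- The squared Euclidean norm of a vector. -/
def sqNorm {X : Type*} [Fintype X] (z : X → ℂ) : ℝ := ∑ x, ‖z x‖ ^ 2

theorem sqNorm_nonneg {X : Type*} [Fintype X] (z : X → ℂ) : 0 ≤ sqNorm z :=
  Finset.sum_nonneg fun _ _ => sq_nonneg _

theorem sqNorm_eq_norm_sq {X : Type*} [Fintype X] (z : X → ℂ) :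
    sqNorm z = ‖(WithLp.toLp 2 z : EuclideanSpace ℂ X)‖ ^ 2 := by
  rw [EuclideanSpace.norm_sq_eq]; rfl

theorem star_dotProduct_self {X : Type*} [Fintype X] (z : X → ℂ) :
    star z ⬝ᵥ z = (sqNorm z : ℂ) := by
  simp only [dotProduct, sqNorm, Pi.star_apply, Complex.ofReal_sum]
  refine Finset.sum_congr rfl fun x _ => ?_
  rw [Complex.star_def, Complex.conj_mul']; norm_cast

theorem norm_sum_mul_sq_le {ι : Type*} [Fintype ι] (f g : ι → ℂ) :
    ‖∑ i, f i * g i‖ ^ 2 ≤ sqNorm f * sqNorm g := by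
  calc ‖∑ i, f i * g i‖ ^ 2 ≤ (∑ i, ‖f i‖ * ‖g i‖) ^ 2 := by
        gcongr
        exact (norm_sum_le _ _).trans_eq (Finset.sum_congr rfl fun i _ => norm_mul _ _)
    _ ≤ _ := Finset.sum_mul_sq_le_sq_mul_sq _ _ _

theorem norm_sum_mul_le {ι : Type*} [Fintype ι] (f g : ι → ℂ) :
    ‖∑ i, f i * g i‖ ≤ √(sqNorm f) * √(sqNorm g) := by
  rw [← Real.sqrt_mul (sqNorm_nonneg f)]
  exact Real.le_sqrt_of_sq_le (norm_sum_mul_sq_le f g)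

theorem sqNorm_star {X : Type*} [Fintype X] (z : X → ℂ) : sqNorm (star z) = sqNorm z := by
  simp [sqNorm]

theorem sqNorm_smul {X : Type*} [Fintype X] (a : ℂ) (z : X → ℂ) :
    sqNorm (a • z) = ‖a‖ ^ 2 * sqNorm z := by
  simp [sqNorm, Finset.mul_sum, mul_pow]

theorem norm_star_dotProduct_sq_le {X : Type*} [Fintype X] (x y : X → ℂ) :
    ‖star x ⬝ᵥ y‖ ^ 2 ≤ sqNorm x * sqNorm y := by
  rw [← sqNorm_star x]
  exact norm_sum_mul_sq_le _ _

/-! ### Bessel families and the trace norm. -/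

/-- A family of vectors satisfying Bessel's inequality. -/
def IsBessel {ι X : Type*} [Fintype ι] [Fintype X] (u : ι → X → ℂ) : Prop :=
  ∀ z : X → ℂ, ∑ i, ‖star (u i) ⬝ᵥ z‖ ^ 2 ≤ sqNorm z

theorem inner_toLp {X : Type*} [Fintype X] (x y : X → ℂ) :
    inner ℂ (WithLp.toLp 2 x : EuclideanSpace ℂ X) (WithLp.toLp 2 y) = star x ⬝ᵥ y := by
  rw [EuclideanSpace.inner_eq_star_dotProduct, dotProduct_comm]

/-- An eigenbasis of `Mᴴ * M` consists of right singular vectors, so its images under `M` are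
orthogonal with lengths the singular values. -/
theorem exists_singular {X : Type} [Fintype X] [DecidableEq X] (M : Matrix X X ℂ) :
    ∃ (u : OrthonormalBasis X ℂ (EuclideanSpace ℂ X)) (s : X → ℝ), (∀ i, 0 ≤ s i) ∧
      traceNorm M = ∑ i, s i ∧
      ∀ i j, star (M *ᵥ (u i).ofLp) ⬝ᵥ (M *ᵥ (u j).ofLp)
        = if i = j then ((s i ^ 2 : ℝ) : ℂ) else 0 := by
  have hM := Matrix.isHermitian_conjTranspose_mul_self M
  have hpos := Matrix.posSemidef_conjTranspose_mul_self M
  refine ⟨hM.eigenvectorBasis, fun i => √(hM.eigenvalues i), fun i => Real.sqrt_nonneg _, rfl, ?_⟩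
  intro i j
  rw [Matrix.star_mulVec, ← Matrix.dotProduct_mulVec, Matrix.mulVec_mulVec,
    hM.mulVec_eigenvectorBasis, Real.sq_sqrt (hpos.eigenvalues_nonneg i)]
  have h := orthonormal_iff_ite.mp hM.eigenvectorBasis.orthonormal i j
  rw [EuclideanSpace.inner_eq_star_dotProduct, dotProduct_comm] at h
  rw [dotProduct_smul, h]
  split_ifs with hij
  · subst hij; simp
  · simp

theorem sqNorm_basis {X : Type} [Fintype X] (u : OrthonormalBasis X ℂ (EuclideanSpace ℂ X))
    (i : X) : sqNorm (u i).ofLp = 1 := by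
  rw [sqNorm_eq_norm_sq]
  have := u.orthonormal.1 i
  simp [this]

theorem isBessel_basis {X : Type} [Fintype X] (u : OrthonormalBasis X ℂ (EuclideanSpace ℂ X)) :
    IsBessel fun i => (u i).ofLp := by
  intro z
  have := u.orthonormal.sum_inner_products_le (WithLp.toLp 2 z) (s := Finset.univ)
  rw [sqNorm_eq_norm_sq]
  refine le_trans (le_of_eq (Finset.sum_congr rfl fun i _ => ?_)) this
  rw [← inner_toLp]

/-- Expand `φ` in right singular vectors: each coefficient is at most 1 in modulus, and each `M u_i`
has length `s_i`. -/
theorem norm_expectation_le_traceNorm {X : Type} [Fintype X] [DecidableEq X]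
    (M : Matrix X X ℂ) (φ : X → ℂ) (hφ : sqNorm φ = 1) :
    ‖star φ ⬝ᵥ (M *ᵥ φ)‖ ≤ traceNorm M := by
  obtain ⟨u, s, hs, htr, hu⟩ := exists_singular M
  have hexp : φ = ∑ i, (star (u i).ofLp ⬝ᵥ φ) • (u i).ofLp := by
    have h := congrArg WithLp.ofLp (u.sum_repr' (WithLp.toLp 2 φ))
    simp only [WithLp.ofLp_sum, WithLp.ofLp_smul] at h
    conv_lhs => rw [← h]
    exact Finset.sum_congr rfl fun i _ => by rw [← inner_toLp]
  have hMφ : M *ᵥ φ = ∑ i, (star (u i).ofLp ⬝ᵥ φ) • (M *ᵥ (u i).ofLp) := by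
    conv_lhs => rw [hexp]
    rw [Matrix.mulVec_sum]
    exact Finset.sum_congr rfl fun i _ => Matrix.mulVec_smul _ _ _
  rw [hMφ, dotProduct_sum, htr]
  refine (norm_sum_le _ _).trans (Finset.sum_le_sum fun i _ => ?_)
  rw [dotProduct_smul, norm_smul]
  have h1 : ‖star (u i).ofLp ⬝ᵥ φ‖ ≤ 1 := by
    have := norm_star_dotProduct_sq_le (u i).ofLp φ
    rw [hφ, sqNorm_basis, one_mul] at this
    exact (sq_le_one_iff₀ (norm_nonneg _)).mp this
  have hn : sqNorm (M *ᵥ (u i).ofLp) = s i ^ 2 := by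
    have := hu i i
    rw [star_dotProduct_self, if_pos rfl] at this
    exact_mod_cast this
  have h2 : ‖star φ ⬝ᵥ (M *ᵥ (u i).ofLp)‖ ≤ s i := by
    have := norm_star_dotProduct_sq_le φ (M *ᵥ (u i).ofLp)
    rw [hφ, hn, one_mul] at this
    exact (sq_le_sq₀ (norm_nonneg _) (hs i)).mp this
  calc _ ≤ 1 * s i := by gcongr
    _ = s i := one_mul _

/-- Polar decomposition: the trace norm is attained by pairing right with left singular vectors.
Combined with the next lemma it bounds trace norms from above without a triangle inequality for
`traceNorm`. -/
theorem exists_isBessel_traceNorm_eq {X : Type} [Fintype X] [DecidableEq X] (M : Matrix X X ℂ) :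
    ∃ u w : X → X → ℂ, IsBessel u ∧ IsBessel w ∧
      (traceNorm M : ℂ) = ∑ i, star (w i) ⬝ᵥ (M *ᵥ u i) := by
  obtain ⟨u, s, hs, htr, hu⟩ := exists_singular M
  -- For `s i = 0` the convention `0⁻¹ = 0` makes the left vector zero, so the left family is only
  -- Bessel, not orthonormal.
  refine ⟨fun i => (u i).ofLp, fun i => ((s i)⁻¹ : ℂ) • (M *ᵥ (u i).ofLp), isBessel_basis u, ?_, ?_⟩
  · intro z
    let t : Finset X := Finset.univ.filter fun i => s i ≠ 0
    let w : t → EuclideanSpace ℂ X := fun i => WithLp.toLp 2 (((s i)⁻¹ : ℂ) • (M *ᵥ (u i).ofLp))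
    have hw : Orthonormal ℂ w := by
      rw [orthonormal_iff_ite]
      intro i j
      have hi : (s i : ℂ) ≠ 0 := by exact_mod_cast (Finset.mem_filter.mp i.2).2
      rw [inner_toLp, star_smul, smul_dotProduct, dotProduct_smul, hu]
      by_cases hij : i = j
      · subst hij
        simp only [if_true, smul_eq_mul]
        have hst : star ((s i : ℂ)⁻¹) = (s i : ℂ)⁻¹ := by
          rw [star_inv₀]; simp
        rw [hst]
        push_cast
        field_simp
      · rw [if_neg (fun h => hij (Subtype.ext h)), if_neg hij]; simp
    have := hw.sum_inner_products_le (WithLp.toLp 2 z) (s := Finset.univ)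
    rw [sqNorm_eq_norm_sq]
    refine le_trans (le_of_eq ?_) this
    have e : ∀ i : t, ‖inner ℂ (w i) (WithLp.toLp 2 z)‖ ^ 2
        = (fun i => ‖star (((s i)⁻¹ : ℂ) • (M *ᵥ (u i).ofLp)) ⬝ᵥ z‖ ^ 2) i.1 := fun i => by
      rw [inner_toLp]
    rw [Finset.sum_congr rfl fun i _ => e i, Finset.sum_coe_sort t
      (fun i => ‖star (((s i)⁻¹ : ℂ) • (M *ᵥ (u i).ofLp)) ⬝ᵥ z‖ ^ 2), Finset.sum_filter_of_ne]
    intro i _ hi h0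
    apply hi
    simp [h0]
  · rw [htr]
    push_cast
    refine Finset.sum_congr rfl fun i _ => ?_
    rw [star_smul, smul_dotProduct, hu, if_pos rfl]
    have hst : star ((s i : ℂ)⁻¹) = (s i : ℂ)⁻¹ := by
      rw [star_inv₀]; simp
    rw [hst, smul_eq_mul]
    by_cases h0 : s i = 0
    · simp [h0]
    · have : (s i : ℂ) ≠ 0 := by exact_mod_cast h0
      push_cast
      field_simp

/-- Cauchy-Schwarz over pairs `(i, a)`, followed by Bessel's inequality for each `p a` and `q a`. -/
theorem norm_sum_isBessel_le {ι κ X : Type*} [Fintype ι] [Fintype κ] [Fintype X]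
    {u w : ι → X → ℂ} (hu : IsBessel u) (hw : IsBessel w) (p q : κ → X → ℂ) :
    ‖∑ i, star (w i) ⬝ᵥ ((∑ a, Matrix.vecMulVec (p a) (star (q a))) *ᵥ u i)‖
      ≤ √(∑ a, sqNorm (p a)) * √(∑ a, sqNorm (q a)) := by
  have h1 : ∑ i, star (w i) ⬝ᵥ ((∑ a, Matrix.vecMulVec (p a) (star (q a))) *ᵥ u i)
      = ∑ x : ι × κ, (star (w x.1) ⬝ᵥ p x.2) * (star (q x.2) ⬝ᵥ u x.1) := by
    rw [Fintype.sum_prod_type]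
    refine Finset.sum_congr rfl fun i _ => ?_
    rw [Matrix.sum_mulVec, dotProduct_sum]
    refine Finset.sum_congr rfl fun a _ => ?_
    rw [Matrix.vecMulVec_mulVec]
    simp [dotProduct_smul, mul_comm]
  rw [h1]
  refine (norm_sum_mul_le _ _).trans ?_
  have hp : sqNorm (fun x : ι × κ => star (w x.1) ⬝ᵥ p x.2) ≤ ∑ a, sqNorm (p a) := by
    rw [sqNorm, Fintype.sum_prod_type_right]
    exact Finset.sum_le_sum fun a _ => hw (p a)
  have hq : sqNorm (fun x : ι × κ => star (q x.2) ⬝ᵥ u x.1) ≤ ∑ a, sqNorm (q a) := by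
    rw [sqNorm, Fintype.sum_prod_type_right]
    refine Finset.sum_le_sum fun a _ => le_trans (le_of_eq ?_) (hu (q a))
    refine Finset.sum_congr rfl fun i _ => ?_
    rw [← norm_star]
    congr 2
    simp [dotProduct, mul_comm]
  gcongr

/-! ### Kraus maps -/

theorem krausMap_apply {ι X Y : Type} [Fintype ι] [Fintype X] (K : ι → Matrix Y X ℂ)
    (ρ : Matrix X X ℂ) : krausMap K ρ = ∑ i, K i * ρ * (K i)ᴴ := rfl

theorem sqNorm_mulVec_sum_of_complete {ι X Y : Type*} [Fintype ι] [Fintype X] [Fintype Y]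
    [DecidableEq X] {K : ι → Matrix Y X ℂ} (hK : ∑ i, (K i)ᴴ * K i = 1) (z : X → ℂ) :
    ∑ i, sqNorm (K i *ᵥ z) = sqNorm z := by
  have h : ((∑ i, sqNorm (K i *ᵥ z) : ℝ) : ℂ) = (sqNorm z : ℂ) := by
    push_cast
    simp only [← star_dotProduct_self, Matrix.star_mulVec, ← Matrix.dotProduct_mulVec,
      Matrix.mulVec_mulVec]
    rw [← dotProduct_sum, ← Matrix.sum_mulVec, hK, Matrix.one_mulVec]
  exact_mod_cast h

theorem mul_vecMulVec_mul_conjTranspose {X Y : Type*} [Fintype X] (K : Matrix Y X ℂ) (z w : X → ℂ) :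
    K * Matrix.vecMulVec z (star w) * Kᴴ = Matrix.vecMulVec (K *ᵥ z) (star (K *ᵥ w)) := by
  rw [Matrix.mul_vecMulVec, Matrix.vecMulVec_mul, Matrix.star_mulVec]

theorem extend_krausMap {ι X Y : Type} [Fintype ι] [Fintype X] (R : Type) [Fintype R]
    [DecidableEq R] (K : ι → Matrix Y X ℂ) (ψ : Matrix (R × X) (R × X) ℂ) :
    extend R (krausMap K) ψ
      = ∑ i, ((1 : Matrix R R ℂ) ⊗ₖ K i) * ψ * ((1 : Matrix R R ℂ) ⊗ₖ K i)ᴴ := by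
  ext p q
  simp only [extend, Matrix.of_apply, krausMap_apply, Matrix.sum_apply]
  refine Finset.sum_congr rfl fun i _ => ?_
  simp only [Matrix.mul_apply, Matrix.conjTranspose_apply, Matrix.kroneckerMap_apply,
    Matrix.one_apply, Matrix.of_apply, Fintype.sum_prod_type, ite_mul, one_mul, zero_mul,
    apply_ite star, star_zero, mul_ite, mul_zero, Finset.sum_ite_irrel, Finset.sum_const_zero,
    Finset.sum_ite_eq, Finset.mem_univ, if_true]

theorem extend_sub {X Y : Type} (R : Type) (S T : Superop X Y) (ψ : Matrix (R × X) (R × X) ℂ) :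
    extend R (S - T) ψ = extend R S ψ - extend R T ψ := by
  ext p q
  simp [extend]

/-- The isometry `|ab⟩ ↦ |ab⟩ ⊗ |χ⟩`, sorted by parties. -/
def adjoinMatrix {C D : Type} (A B : Type) [DecidableEq A] [DecidableEq B] (χ : C × D → ℂ) :
    Matrix ((A × C) × (B × D)) (A × B) ℂ :=
  Matrix.of fun p q => if (p.1.1, p.2.1) = q then χ (p.1.2, p.2.2) else 0

theorem adjoinState_apply {C D A B : Type} [Fintype A] [Fintype B] [DecidableEq A]
    [DecidableEq B] (χ : C × D → ℂ) (ρ : Matrix (A × B) (A × B) ℂ) :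
    adjoinState A B χ ρ = adjoinMatrix A B χ * ρ * (adjoinMatrix A B χ)ᴴ := by
  ext p q
  simp only [adjoinState, adjoinMatrix, Matrix.mul_apply, Matrix.of_apply, LinearMap.coe_mk,
    AddHom.coe_mk, Matrix.conjTranspose_apply, ite_mul, zero_mul, Finset.sum_ite_eq,
    Finset.mem_univ, if_true, apply_ite star, star_zero, mul_ite, mul_zero]
  ring

/-! ### Low rank and the overlap bound. -/

theorem exists_orthonormal_span {κ P : Type*} [Fintype κ] [Fintype P] (v : κ → P → ℂ) :
    ∃ (n : ℕ) (o : Fin n → P → ℂ), n ≤ Fintype.card κ ∧ (∀ k, sqNorm (o k) = 1) ∧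
      IsBessel o ∧ ∀ w : κ → ℂ, ∑ x, w x • v x
        = ∑ k, (star (o k) ⬝ᵥ ∑ x, w x • v x) • o k := by
  let v' : κ → EuclideanSpace ℂ P := fun x => WithLp.toLp 2 (v x)
  let S := Submodule.span ℂ (Set.range v')
  let b := stdOrthonormalBasis ℂ S
  have hb : Orthonormal ℂ fun k => (b k : EuclideanSpace ℂ P) := by
    have := b.orthonormal.comp_linearIsometry S.subtypeₗᵢ
    exact this
  refine ⟨Module.finrank ℂ S, fun k => (b k : EuclideanSpace ℂ P).ofLp, finrank_range_le_card v',
    fun k => ?_, fun z => ?_, fun w => ?_⟩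
  · rw [sqNorm_eq_norm_sq]
    have := hb.1 k
    simp only [WithLp.toLp_ofLp]
    rw [this]; norm_num
  · have := hb.sum_inner_products_le (WithLp.toLp 2 z) (s := Finset.univ)
    rw [sqNorm_eq_norm_sq]
    refine le_trans (le_of_eq (Finset.sum_congr rfl fun i _ => ?_)) this
    rw [← inner_toLp]
  · have hy : ∑ x, w x • v' x ∈ S :=
      Submodule.sum_mem _ fun x _ => Submodule.smul_mem _ _ (Submodule.subset_span ⟨x, rfl⟩)
    have h := b.sum_repr' ⟨_, hy⟩
    have h2 := congrArg (fun y : S => (y : EuclideanSpace ℂ P).ofLp) h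
    simp only [Submodule.coe_sum, Submodule.coe_smul, Submodule.coe_inner, WithLp.ofLp_sum,
      WithLp.ofLp_smul] at h2
    have e : ∑ x, w x • v x = ∑ x, w x • (v' x).ofLp := rfl
    rw [e, ← h2]
    refine Finset.sum_congr rfl fun k _ => ?_
    rw [h2, ← inner_toLp]
    simp only [WithLp.toLp_ofLp, WithLp.toLp_sum, WithLp.toLp_smul]

/-- The adjoint of a contraction is a contraction: `‖a* o‖² = ⟨a a* o, o⟩ ≤ ‖a* o‖ ‖o‖`. -/
theorem sqNorm_adjoint_le {ι κ : Type*} [Fintype ι] [Fintype κ] {a : ι → κ → ℂ}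
    (ha : ∀ z : κ → ℂ, ∑ i, ‖∑ x, a i x * z x‖ ^ 2 ≤ sqNorm z) (o : ι → ℂ) :
    sqNorm (fun x => ∑ i, star (a i x) * o i) ≤ sqNorm o := by
  set y : κ → ℂ := fun x => ∑ i, star (a i x) * o i with hy
  have h1 : (sqNorm y : ℂ) = ∑ i, star (∑ x, a i x * y x) * o i := by
    rw [← star_dotProduct_self]
    simp only [dotProduct, Pi.star_apply, star_sum, star_mul', Finset.sum_mul]
    rw [Finset.sum_comm]
    refine Finset.sum_congr rfl fun x _ => ?_
    conv_lhs => rw [hy]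
    simp only [Finset.mul_sum]
    refine Finset.sum_congr rfl fun i _ => by ring
  have h2 : sqNorm y ^ 2 ≤ sqNorm y * sqNorm o := by
    calc sqNorm y ^ 2 = ‖(sqNorm y : ℂ)‖ ^ 2 := by simp
      _ ≤ sqNorm (fun i => star (∑ x, a i x * y x)) * sqNorm o := by
        rw [h1]; exact norm_sum_mul_sq_le _ _
      _ ≤ _ := by
        gcongr
        · exact sqNorm_nonneg _
        · exact (sqNorm_star fun i => ∑ x, a i x * y x).trans_le (ha y)
  rcases (sqNorm_nonneg y).eq_or_lt with h | h
  · rw [← h]; exact sqNorm_nonneg _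
  · nlinarith

/-- The overlap of a low-rank block family with a tensor power of a contraction of bounded rank. -/
theorem norm_overlap_sq_le {I J T κ : Type*} [Fintype I] [Fintype J] [Fintype T] [Fintype κ]
    (a : I → κ → ℂ) (b : J → κ → ℂ)
    (ha : ∀ z : κ → ℂ, ∑ i, ‖∑ x, a i x * z x‖ ^ 2 ≤ sqNorm z)
    (hb : ∀ z : κ → ℂ, ∑ j, ‖∑ x, b j x * z x‖ ^ 2 ≤ sqNorm z)
    (V : I → T → κ → ℂ) (W : J → T → κ → ℂ) :
    ‖∑ i, ∑ j, star (∑ x, a i x * b j x) * ∑ l, ∑ x, V i l x * W j l x‖ ^ 2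
      ≤ Fintype.card κ * ∑ i, ∑ j, ∑ l, ∑ l', ‖∑ x, V i l x * W j l' x‖ ^ 2 := by
  obtain ⟨n, o, hn, ho1, hoB, hspan⟩ :=
    exists_orthonormal_span (P := T × I) fun (x : κ) (p : T × I) => V p.2 p.1 x
  -- The block matrix with rows `(l, j)` and columns `(l', i)` factors through `κ`. Its rows
  -- therefore lie in a space of dimension at most `card κ`, spanned by the orthonormal `o`. The
  -- overlap only reads the blocks `l = l'`, but the rank argument needs all of them.
  let y : T × J → T × I → ℂ := fun q p => ∑ x, V p.2 p.1 x * W q.2 q.1 x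
  have hy : ∀ q, y q = ∑ k, (star (o k) ⬝ᵥ y q) • o k := fun q => by
    have h := hspan fun x => W q.2 q.1 x
    have e : (∑ x, W q.2 q.1 x • fun p : T × I => V p.2 p.1 x) = y q := by
      ext p
      simp [y, mul_comm]
    rwa [e] at h
  let α : I → J → ℂ := fun i j => ∑ x, a i x * b j x
  have hα : ∀ t : I → ℂ, ∑ j, ‖∑ i, star (α i j) * t i‖ ^ 2 ≤ sqNorm t := fun t => by
    refine le_trans ?_ (sqNorm_adjoint_le ha t)
    set s : κ → ℂ := fun x => ∑ i, star (a i x) * t i with hs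
    rw [← sqNorm_star s]
    refine le_trans (le_of_eq (Finset.sum_congr rfl fun j _ => ?_)) (hb (star s))
    rw [← norm_star]
    congr 2
    simp only [α, hs, star_sum, star_mul', star_star, Pi.star_apply, Finset.mul_sum, Finset.sum_mul]
    rw [Finset.sum_comm]
    exact Finset.sum_congr rfl fun x _ => Finset.sum_congr rfl fun i _ => by ring
  have key : ∑ i, ∑ j, star (α i j) * ∑ l, ∑ x, V i l x * W j l x
      = ∑ p : Fin n × T × J, (star (o p.1) ⬝ᵥ y p.2) *
          ∑ i, star (α i p.2.2) * o p.1 (p.2.1, i) := by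
    have h1 : ∀ i j l, ∑ x, V i l x * W j l x
        = ∑ k, (star (o k) ⬝ᵥ y (l, j)) * o k (l, i) := fun i j l => by
      have := congrFun (hy (l, j)) (l, i)
      simp only [Finset.sum_apply, Pi.smul_apply, smul_eq_mul] at this
      exact this
    simp only [h1, Finset.mul_sum, Fintype.sum_prod_type]
    rw [Finset.sum_comm]
    have : ∀ j, ∑ i, ∑ l, ∑ k, star (α i j) * (star (o k) ⬝ᵥ y (l, j) * o k (l, i))
        = ∑ k, ∑ l, ∑ i, star (o k) ⬝ᵥ y (l, j) * (star (α i j) * o k (l, i)) := fun j => by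
      rw [Finset.sum_comm]
      conv_lhs => enter [2, l]; rw [Finset.sum_comm]
      rw [Finset.sum_comm]
      exact Finset.sum_congr rfl fun k _ => Finset.sum_congr rfl fun l _ =>
        Finset.sum_congr rfl fun i _ => by ring
    simp only [this]
    rw [Finset.sum_comm]
    exact Finset.sum_congr rfl fun k _ => Finset.sum_comm
  change ‖∑ i, ∑ j, star (α i j) * ∑ l, ∑ x, V i l x * W j l x‖ ^ 2 ≤ _
  rw [key]
  refine (norm_sum_mul_sq_le _ _).trans ?_
  rw [mul_comm]
  -- The matrix `α` is a product of two contractions, so applying its adjoint to each slice of the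
  -- unit vector `o k` does not increase the norm. Each `k` contributes at most 1, and there are at
  -- most `card κ` of them.
  have hA : sqNorm (fun p : Fin n × T × J => ∑ i, star (α i p.2.2) * o p.1 (p.2.1, i))
      ≤ Fintype.card κ := by
    simp only [sqNorm, Fintype.sum_prod_type]
    calc _ ≤ ∑ k : Fin n, (1 : ℝ) := Finset.sum_le_sum fun k _ => ?_
      _ = n := by simp
      _ ≤ _ := by exact_mod_cast hn
    rw [← ho1 k, sqNorm, Fintype.sum_prod_type]
    exact Finset.sum_le_sum fun l _ => hα fun i => o k (l, i)
  have hB : sqNorm (fun p : Fin n × T × J => star (o p.1) ⬝ᵥ y p.2)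
      ≤ ∑ i, ∑ j, ∑ l, ∑ l', ‖∑ x, V i l x * W j l' x‖ ^ 2 := by
    calc _ = ∑ q : T × J, ∑ k, ‖star (o k) ⬝ᵥ y q‖ ^ 2 := by
          rw [sqNorm, Fintype.sum_prod_type_right]
      _ ≤ ∑ q : T × J, sqNorm (y q) := Finset.sum_le_sum fun q _ => hoB _
      _ = _ := by
        simp only [sqNorm, Fintype.sum_prod_type, y]
        rw [Finset.sum_comm]
        conv_lhs => enter [2, j]; rw [Finset.sum_comm]
        conv_lhs => enter [2, j, 2, l]; rw [Finset.sum_comm]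
        conv_lhs => enter [2, j]; rw [Finset.sum_comm]
        rw [Finset.sum_comm]
  have := sqNorm_nonneg (fun p : Fin n × T × J => star (o p.1) ⬝ᵥ y p.2)
  gcongr

/-! ### Protocols as sums over transcripts. -/

/-- `N` splits into `2 ^ c` completely positive maps, one for every transcript, all with Kraus
operators of product form whose local factors form contractions. -/
def HasProductKraus {A' B' A B : Type} [Fintype A'] [Fintype B'] [Fintype A] [Fintype B]
    (c : ℕ) (N : Superop (A × B) (A' × B')) : Prop :=
  ∃ (M : Type) (_ : Fintype M) (I J : M → Type) (_ : ∀ m, Fintype (I m))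
    (_ : ∀ m, Fintype (J m)) (K : ∀ m, I m → Matrix A' A ℂ) (L : ∀ m, J m → Matrix B' B ℂ),
    Fintype.card M = 2 ^ c ∧
    (∀ ρ, N ρ = ∑ m, ∑ i, ∑ j, (K m i ⊗ₖ L m j) * ρ * (K m i ⊗ₖ L m j)ᴴ) ∧
    (∀ m z, ∑ i, sqNorm (K m i *ᵥ z) ≤ sqNorm z) ∧
    (∀ m z, ∑ j, sqNorm (L m j *ᵥ z) ≤ sqNorm z) ∧
    (∀ z, ∑ m, ∑ i, ∑ j, sqNorm ((K m i ⊗ₖ L m j) *ᵥ z) = sqNorm z)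

theorem hasProductKraus_finish {A' B' A B : Type} [Fintype A'] [Fintype B'] [Fintype A]
    [Fintype B] [DecidableEq A] [DecidableEq B] {r s : ℕ}
    (K : Fin r → Matrix A' A ℂ) (L : Fin s → Matrix B' B ℂ)
    (hK : ∑ i, (K i)ᴴ * K i = 1) (hL : ∑ j, (L j)ᴴ * L j = 1) :
    HasProductKraus 0 (krausMap (fun ij : Fin r × Fin s => K ij.1 ⊗ₖ L ij.2)) := by
  refine ⟨Unit, inferInstance, fun _ => Fin r, fun _ => Fin s, fun _ => inferInstance,
    fun _ => inferInstance, fun _ => K, fun _ => L, by simp, fun ρ => ?_,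
    fun _ z => (sqNorm_mulVec_sum_of_complete hK z).le,
    fun _ z => (sqNorm_mulVec_sum_of_complete hL z).le, fun z => ?_⟩
  · simp [krausMap_apply, Fintype.sum_prod_type]
  · have hKL : ∑ ij : Fin r × Fin s, (K ij.1 ⊗ₖ L ij.2)ᴴ * (K ij.1 ⊗ₖ L ij.2) = 1 := by
      simp only [Matrix.conjTranspose_kronecker, ← Matrix.mul_kronecker_mul,
        Fintype.sum_prod_type]
      rw [← Matrix.one_kronecker_one, ← hK, ← hL]
      ext p q
      simp only [Matrix.sum_apply, Matrix.kroneckerMap_apply, Finset.sum_mul_sum]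
    have := sqNorm_mulVec_sum_of_complete hKL z
    rw [Fintype.sum_prod_type] at this
    simpa using this

theorem HasProductKraus.aliceSends {A' B' A B A₁ : Type} [Fintype A'] [Fintype B'] [Fintype A]
    [Fintype B] [Fintype A₁] [DecidableEq A] [DecidableEq B] {r c : ℕ}
    (K : Bool → Fin r → Matrix A₁ A ℂ) (hK : ∑ b, ∑ i, (K b i)ᴴ * K b i = 1)
    (N : Bool → Superop (A₁ × B) (A' × B')) (ih : ∀ b, HasProductKraus c (N b)) :
    HasProductKraus (c + 1) (∑ b, N b ∘ₗ krausMap (fun i => K b i ⊗ₖ (1 : Matrix B B ℂ))) := by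
  choose M fM I J fI fJ K' L' hcard hN' hK' hL' hT using ih
  have hKs : ∀ z, ∑ b, ∑ i, sqNorm (K b i *ᵥ z) = sqNorm z := fun z => by
    have := sqNorm_mulVec_sum_of_complete (K := fun x : Bool × Fin r => K x.1 x.2)
      (by rw [Fintype.sum_prod_type]; exact hK) z
    rwa [Fintype.sum_prod_type] at this
  have hKs' : ∀ z : A × B → ℂ,
      ∑ b, ∑ i, sqNorm ((K b i ⊗ₖ (1 : Matrix B B ℂ)) *ᵥ z) = sqNorm z := fun z => by
    have := sqNorm_mulVec_sum_of_complete
      (K := fun x : Bool × Fin r => K x.1 x.2 ⊗ₖ (1 : Matrix B B ℂ)) (by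
        simp only [Matrix.conjTranspose_kronecker, ← Matrix.mul_kronecker_mul,
          Fintype.sum_prod_type, Matrix.conjTranspose_one, Matrix.one_mul]
        rw [← Matrix.one_kronecker_one, ← hK]
        ext p q
        simp only [Matrix.sum_apply, Matrix.kroneckerMap_apply, Finset.sum_mul]) z
    rwa [Fintype.sum_prod_type] at this
  have hkr : ∀ b m i' i j, (K' b m i * K b i') ⊗ₖ L' b m j
      = (K' b m i ⊗ₖ L' b m j) * (K b i' ⊗ₖ (1 : Matrix B B ℂ)) := fun b m i' i j => by
    rw [← Matrix.mul_kronecker_mul, Matrix.mul_one]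
  refine ⟨Σ b, M b, inferInstance, fun m => Fin r × I m.1 m.2, fun m => J m.1 m.2,
    fun m => inferInstance, fun m => inferInstance,
    fun m i => K' m.1 m.2 i.2 * K m.1 i.1, fun m j => L' m.1 m.2 j, ?_, fun ρ => ?_,
    fun m z => ?_, fun m z => hL' _ _ z, fun z => ?_⟩
  · simp only [Fintype.card_sigma, hcard]
    simp; ring
  · simp only [LinearMap.sum_apply, LinearMap.comp_apply, krausMap_apply, map_sum]
    simp only [Fintype.sum_sigma, Fintype.sum_prod_type, hN', hkr, Matrix.conjTranspose_mul]
    refine Finset.sum_congr rfl fun b _ => ?_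
    rw [Finset.sum_comm]
    refine Finset.sum_congr rfl fun m _ => Finset.sum_congr rfl fun i' _ =>
      Finset.sum_congr rfl fun i _ => Finset.sum_congr rfl fun j _ => ?_
    simp only [Matrix.mul_assoc]
  -- Fixing the transcript keeps only one branch of the completeness relation, which is why the
  -- local factors are contractions rather than complete families.
  · simp only [Fintype.sum_prod_type, ← Matrix.mulVec_mulVec]
    calc _ ≤ ∑ i, sqNorm (K m.1 i *ᵥ z) := Finset.sum_le_sum fun i _ => hK' _ _ _
      _ ≤ ∑ b, ∑ i, sqNorm (K b i *ᵥ z) :=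
        Finset.single_le_sum (f := fun b => ∑ i, sqNorm (K b i *ᵥ z))
          (fun b _ => Finset.sum_nonneg fun i _ => sqNorm_nonneg _) (Finset.mem_univ m.1)
      _ = _ := hKs z
  · simp only [Fintype.sum_sigma, Fintype.sum_prod_type, hkr, ← Matrix.mulVec_mulVec]
    rw [← hKs' z]
    refine Finset.sum_congr rfl fun b _ => ?_
    rw [Finset.sum_comm]
    exact Finset.sum_congr rfl fun i' _ => hT b _

theorem HasProductKraus.bobSends {A' B' A B B₁ : Type} [Fintype A'] [Fintype B'] [Fintype A]
    [Fintype B] [Fintype B₁] [DecidableEq A] [DecidableEq B] {r c : ℕ}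
    (L : Bool → Fin r → Matrix B₁ B ℂ) (hL : ∑ b, ∑ j, (L b j)ᴴ * L b j = 1)
    (N : Bool → Superop (A × B₁) (A' × B')) (ih : ∀ b, HasProductKraus c (N b)) :
    HasProductKraus (c + 1) (∑ b, N b ∘ₗ krausMap (fun j => (1 : Matrix A A ℂ) ⊗ₖ L b j)) := by
  choose M fM I J fI fJ K' L' hcard hN' hK' hL' hT using ih
  have hLs : ∀ z, ∑ b, ∑ i, sqNorm (L b i *ᵥ z) = sqNorm z := fun z => by
    have := sqNorm_mulVec_sum_of_complete (K := fun x : Bool × Fin r => L x.1 x.2)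
      (by rw [Fintype.sum_prod_type]; exact hL) z
    rwa [Fintype.sum_prod_type] at this
  have hLs' : ∀ z : A × B → ℂ,
      ∑ b, ∑ i, sqNorm (((1 : Matrix A A ℂ) ⊗ₖ L b i) *ᵥ z) = sqNorm z := fun z => by
    have := sqNorm_mulVec_sum_of_complete
      (K := fun x : Bool × Fin r => (1 : Matrix A A ℂ) ⊗ₖ L x.1 x.2) (by
        simp only [Matrix.conjTranspose_kronecker, ← Matrix.mul_kronecker_mul,
          Fintype.sum_prod_type, Matrix.conjTranspose_one, Matrix.one_mul]
        rw [← Matrix.one_kronecker_one, ← hL]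
        ext p q
        simp only [Matrix.sum_apply, Matrix.kroneckerMap_apply, Finset.mul_sum]) z
    rwa [Fintype.sum_prod_type] at this
  have hkr : ∀ b m i i' j, K' b m i ⊗ₖ (L' b m j * L b i')
      = (K' b m i ⊗ₖ L' b m j) * ((1 : Matrix A A ℂ) ⊗ₖ L b i') := fun b m i' i j => by
    rw [← Matrix.mul_kronecker_mul, Matrix.mul_one]
  refine ⟨Σ b, M b, inferInstance, fun m => I m.1 m.2, fun m => Fin r × J m.1 m.2,
    fun m => inferInstance, fun m => inferInstance,
    fun m i => K' m.1 m.2 i, fun m j => L' m.1 m.2 j.2 * L m.1 j.1, ?_, fun ρ => ?_,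
    fun m z => hK' _ _ z, fun m z => ?_, fun z => ?_⟩
  · simp only [Fintype.card_sigma, hcard]
    simp; ring
  · simp only [LinearMap.sum_apply, LinearMap.comp_apply, krausMap_apply, map_sum]
    simp only [Fintype.sum_sigma, Fintype.sum_prod_type, hN', hkr, Matrix.conjTranspose_mul]
    refine Finset.sum_congr rfl fun b _ => ?_
    rw [Finset.sum_comm]
    refine Finset.sum_congr rfl fun m _ => ?_
    rw [Finset.sum_comm]
    refine Finset.sum_congr rfl fun i' _ =>
      Finset.sum_congr rfl fun i _ => Finset.sum_congr rfl fun j _ => ?_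
    simp only [Matrix.mul_assoc]
  · simp only [Fintype.sum_prod_type, ← Matrix.mulVec_mulVec]
    calc _ ≤ ∑ i, sqNorm (L m.1 i *ᵥ z) := Finset.sum_le_sum fun i _ => hL' _ _ _
      _ ≤ ∑ b, ∑ i, sqNorm (L b i *ᵥ z) :=
        Finset.single_le_sum (f := fun b => ∑ i, sqNorm (L b i *ᵥ z))
          (fun b _ => Finset.sum_nonneg fun i _ => sqNorm_nonneg _) (Finset.mem_univ m.1)
      _ = _ := hLs z
  · simp only [Fintype.sum_sigma, Fintype.sum_prod_type, hkr, ← Matrix.mulVec_mulVec]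
    rw [← hLs' z]
    refine Finset.sum_congr rfl fun b _ => ?_
    have : ∀ m, ∑ i, ∑ x, ∑ j, sqNorm ((K' b m i ⊗ₖ L' b m j) *ᵥ ((1 : Matrix A A ℂ) ⊗ₖ L b x) *ᵥ z)
        = ∑ x, ∑ i, ∑ j, sqNorm ((K' b m i ⊗ₖ L' b m j) *ᵥ ((1 : Matrix A A ℂ) ⊗ₖ L b x) *ᵥ z) :=
      fun m => Finset.sum_comm
    simp only [this]
    rw [Finset.sum_comm]
    exact Finset.sum_congr rfl fun i' _ => hT b _

theorem IsLOCC.hasProductKraus {A' B' : Type} [Fintype A'] [Fintype B'] {c : ℕ} {A B : Type}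
    [Fintype A] [Fintype B] [DecidableEq A] [DecidableEq B] {N : Superop (A × B) (A' × B')}
    (h : IsLOCC A' B' c A B N) : HasProductKraus c N := by
  induction h with
  | finish K L hK hL => exact hasProductKraus_finish K L hK hL
  | aliceSends K hK N _ ih => exact .aliceSends K hK N ih
  | bobSends L hL N _ ih => exact .bobSends L hL N ih

/-! ### Entanglement fidelity from the diamond norm -/

theorem one_kronecker_mulVec {R X Y : Type} [Fintype R] [DecidableEq R] [Fintype X]
    (K : Matrix Y X ℂ) (ω : R → X → ℂ) (p : R × Y) :
    (((1 : Matrix R R ℂ) ⊗ₖ K) *ᵥ fun q => ω q.1 q.2) p = (K *ᵥ ω p.1) p.2 := by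
  simp [Matrix.mulVec, dotProduct, Fintype.sum_prod_type, Matrix.one_apply, ite_mul,
    Finset.sum_ite_irrel]

/-- The target output is pure, so its fidelity with the simulated output is an expectation value. It
differs from 1 by an expectation of the difference of the outputs, which the trace norm bounds. -/
theorem one_sub_le_fidelity_fin {X τ : Type} [Fintype X] [DecidableEq X] [Fintype τ]
    (K : τ → Matrix X X ℂ) (U : Matrix X X ℂ) {ε : ℝ} (hε : 0 ≤ ε)
    (h : diamondNorm (krausMap K - conjChannel U) ≤ ENNReal.ofReal ε) {n : ℕ}
    (ω : Fin n → X → ℂ) (hω : ∑ r, sqNorm (ω r) = 1) (hU : ∑ r, sqNorm (U *ᵥ ω r) = 1) :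
    1 - ε ≤ ∑ t, ‖∑ r, star (U *ᵥ ω r) ⬝ᵥ (K t *ᵥ ω r)‖ ^ 2 := by
  set w : Fin n × X → ℂ := fun p => ω p.1 p.2 with hw
  set φ : Fin n × X → ℂ := fun p => (U *ᵥ ω p.1) p.2 with hφ
  have hw1 : sqNorm w = 1 := by rw [← hω, sqNorm, Fintype.sum_prod_type]; rfl
  have hφ1 : sqNorm φ = 1 := by rw [← hU, sqNorm, Fintype.sum_prod_type]; rfl
  have hψ := Matrix.posSemidef_vecMulVec_self_star w
  have htr : (Matrix.vecMulVec w (star w)).trace = 1 := by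
    rw [Matrix.trace_vecMulVec, dotProduct_comm, star_dotProduct_self, hw1]; simp
  have h1 : ENNReal.ofReal (traceNorm (extend (Fin n) (krausMap K - conjChannel U)
      (Matrix.vecMulVec w (star w)))) ≤ ENNReal.ofReal ε :=
    le_trans (by
      unfold diamondNorm
      refine le_iSup_of_le n ?_
      refine le_iSup_of_le (Matrix.vecMulVec w (star w)) ?_
      exact le_iSup_of_le hψ (le_iSup_of_le htr le_rfl)) h
  rw [ENNReal.ofReal_le_ofReal_iff hε] at h1
  have h2 := (norm_expectation_le_traceNorm _ φ hφ1).trans h1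
  have hexp : ∀ v : Fin n × X → ℂ, star φ ⬝ᵥ (Matrix.vecMulVec v (star v) *ᵥ φ)
      = ((‖star φ ⬝ᵥ v‖ ^ 2 : ℝ) : ℂ) := fun v => by
    rw [Matrix.vecMulVec_mulVec, dotProduct_smul]
    have : star v ⬝ᵥ φ = star (star φ ⬝ᵥ v) := by simp [dotProduct, mul_comm]
    rw [this]
    simp only [MulOpposite.smul_eq_mul_unop, MulOpposite.unop_op]
    rw [Complex.star_def, Complex.mul_conj']; norm_cast
  have hd : ∀ K : Matrix X X ℂ, star φ ⬝ᵥ (fun p : Fin n × X => (K *ᵥ ω p.1) p.2)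
      = ∑ r, star (U *ᵥ ω r) ⬝ᵥ (K *ᵥ ω r) := fun K => by
    rw [dotProduct, Fintype.sum_prod_type]; rfl
  have hk : ∀ K : Matrix X X ℂ, ((1 : Matrix (Fin n) (Fin n) ℂ) ⊗ₖ K)
      * Matrix.vecMulVec w (star w) * ((1 : Matrix (Fin n) (Fin n) ℂ) ⊗ₖ K)ᴴ
      = Matrix.vecMulVec (fun p : Fin n × X => (K *ᵥ ω p.1) p.2)
          (star fun p : Fin n × X => (K *ᵥ ω p.1) p.2) := fun K => by
    rw [mul_vecMulVec_mul_conjTranspose]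
    congr
    · exact funext (one_kronecker_mulVec K ω)
    · exact funext (one_kronecker_mulVec K ω)
  rw [extend_sub, conjChannel, extend_krausMap, extend_krausMap, Matrix.sub_mulVec,
    dotProduct_sub, Matrix.sum_mulVec, dotProduct_sum] at h2
  simp only [hk, Finset.univ_unique, Finset.sum_singleton] at h2
  rw [Finset.sum_congr rfl fun t _ => hexp _, hexp] at h2
  have h3 : star φ ⬝ᵥ (fun p : Fin n × X => (U *ᵥ ω p.1) p.2) = 1 := by
    have := star_dotProduct_self φ
    rw [hφ1] at this
    simpa using this
  rw [h3] at h2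
  simp only [hd] at h2
  rw [← Complex.ofReal_sum, ← Complex.ofReal_sub, Complex.norm_real, Real.norm_eq_abs] at h2
  have := (abs_le.mp h2).1
  simp only [norm_one] at this
  linarith

theorem one_sub_le_fidelity {X τ R : Type} [Fintype X] [DecidableEq X] [Fintype τ] [Fintype R]
    (K : τ → Matrix X X ℂ) (U : Matrix X X ℂ) {ε : ℝ} (hε : 0 ≤ ε)
    (h : diamondNorm (krausMap K - conjChannel U) ≤ ENNReal.ofReal ε)
    (ω : R → X → ℂ) (hω : ∑ r, sqNorm (ω r) = 1) (hU : ∑ r, sqNorm (U *ᵥ ω r) = 1) :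
    1 - ε ≤ ∑ t, ‖∑ r, star (U *ᵥ ω r) ⬝ᵥ (K t *ᵥ ω r)‖ ^ 2 := by
  -- The diamond norm quantifies over references `Fin n` only, so a general finite reference is
  -- relabelled.
  let e := (Fintype.equivFin R).symm
  have := one_sub_le_fidelity_fin K U hε h (fun r => ω (e r))
    (by rw [← hω]; exact e.sum_comp fun r => sqNorm (ω r))
    (by rw [← hU]; exact e.sum_comp fun r => sqNorm (U *ᵥ ω r))
  refine this.trans_eq (Finset.sum_congr rfl fun t _ => ?_)
  rw [e.sum_comp fun r => star (U *ᵥ ω r) ⬝ᵥ (K t *ᵥ ω r)]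

theorem sqNorm_adjoinMatrix_mulVec {A B C D : Type} [Fintype A] [Fintype B] [Fintype C] [Fintype D]
    [DecidableEq A] [DecidableEq B] (χ : C × D → ℂ) (z : A × B → ℂ) :
    sqNorm (adjoinMatrix A B χ *ᵥ z) = sqNorm z * sqNorm χ := by
  simp only [sqNorm, adjoinMatrix, Matrix.mulVec, dotProduct, Matrix.of_apply, ite_mul, zero_mul,
    Finset.sum_ite_eq, Finset.mem_univ, if_true, norm_mul, mul_pow, Finset.sum_mul_sum]
  simp only [Fintype.sum_prod_type, mul_comm]
  refine Finset.sum_congr rfl fun a _ => ?_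
  rw [Finset.sum_comm]

/-! ### The vectors `|00⟩` and `|Φ⟩` -/

theorem sum_ketZero_mul (d : ℕ) (h : Fin (d + 1) × Fin (d + 1) → ℂ) :
    ∑ x, ketZero d x * h x = h (0, 0) := by
  simp [ketZero, Pi.single_apply]

theorem sum_ketPhi_mul (d : ℕ) (h : Fin (d + 1) × Fin (d + 1) → ℂ) :
    ∑ x, ketPhi d x * h x = ((1 / √(d : ℝ) : ℝ) : ℂ) * ∑ s : Fin d, h (s.succ, s.succ) := by
  simp only [ketPhi, Fintype.sum_prod_type, Fin.sum_univ_succ (n := d), ite_mul, zero_mul]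
  simp [Fin.succ_ne_zero, (Fin.succ_ne_zero _).symm, Finset.mul_sum]

theorem star_ketZero (d : ℕ) : star (ketZero d) = ketZero d := by
  ext x; simp [ketZero, Pi.single_apply, apply_ite star]

theorem star_ketPhi (d : ℕ) : star (ketPhi d) = ketPhi d := by
  ext x; simp [ketPhi, apply_ite (starRingEnd ℂ)]

theorem ketZero_dotProduct_ketZero (d : ℕ) : ketZero d ⬝ᵥ ketZero d = 1 := by
  rw [dotProduct, sum_ketZero_mul]; simp [ketZero]

theorem ketZero_dotProduct_ketPhi (d : ℕ) : ketZero d ⬝ᵥ ketPhi d = 0 := by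
  rw [dotProduct, sum_ketZero_mul]; simp [ketPhi]

theorem ketPhi_dotProduct_ketPhi {d : ℕ} (hd : 1 ≤ d) : ketPhi d ⬝ᵥ ketPhi d = 1 := by
  rw [dotProduct, sum_ketPhi_mul]
  have : (0 : ℝ) < d := by exact_mod_cast hd
  simp only [ketPhi, Fin.succ_ne_zero, ne_eq, not_false_eq_true, and_self, if_true,
    Finset.sum_const, Finset.card_univ, Fintype.card_fin, nsmul_eq_mul]
  norm_cast
  field_simp
  rw [Real.sq_sqrt this.le]

theorem gate_mulVec {d : ℕ} (hd : 1 ≤ d) (a b : ℂ) :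
    gate d *ᵥ (a • ketZero d + b • ketPhi d) = a • ketPhi d + b • ketZero d := by
  have h1 := ketZero_dotProduct_ketZero d
  have h2 := ketZero_dotProduct_ketPhi d
  have h3 := ketPhi_dotProduct_ketPhi hd
  have h4 : ketPhi d ⬝ᵥ ketZero d = 0 := by rw [dotProduct_comm, h2]
  simp only [gate, ketBra, Matrix.add_mulVec, Matrix.sub_mulVec, Matrix.vecMulVec_mulVec,
    star_ketZero, star_ketPhi, dotProduct_add, dotProduct_smul, h1, h2, h3, h4, Matrix.one_mulVec]
  ext x
  simp
  ring

theorem sqNorm_ket_combination {d : ℕ} (hd : 1 ≤ d) (a b : ℂ) :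
    sqNorm (a • ketZero d + b • ketPhi d) = ‖a‖ ^ 2 + ‖b‖ ^ 2 := by
  have h1 := ketZero_dotProduct_ketZero d
  have h2 := ketZero_dotProduct_ketPhi d
  have h3 := ketPhi_dotProduct_ketPhi hd
  have h4 : ketPhi d ⬝ᵥ ketZero d = 0 := by rw [dotProduct_comm, h2]
  have h : (sqNorm (a • ketZero d + b • ketPhi d) : ℂ) = ((‖a‖ ^ 2 + ‖b‖ ^ 2 : ℝ) : ℂ) := by
    rw [← star_dotProduct_self]
    simp only [star_add, star_smul, star_ketZero, star_ketPhi, add_dotProduct, dotProduct_add,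
      smul_dotProduct, dotProduct_smul, h1, h2, h3, h4]
    push_cast
    rw [← Complex.conj_mul', ← Complex.conj_mul']
    simp [mul_comm]
  exact_mod_cast h

theorem sqNorm_ketZero {d : ℕ} (hd : 1 ≤ d) : sqNorm (ketZero d) = 1 := by
  simpa using sqNorm_ket_combination hd 1 0

theorem sqNorm_ketPhi {d : ℕ} (hd : 1 ≤ d) : sqNorm (ketPhi d) = 1 := by
  simpa using sqNorm_ket_combination hd 0 1

theorem eprPairs_apply (k : ℕ) (p : (Fin k → Fin 2) × (Fin k → Fin 2)) :
    eprPairs k p = if p.1 = p.2 then (((1 / √2) ^ k : ℝ) : ℂ) else 0 := by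
  simp only [eprPairs, eprPair]
  split_ifs with h
  · simp [h]
  · obtain ⟨i, hi⟩ := Function.ne_iff.mp h
    exact Finset.prod_eq_zero (Finset.mem_univ i) (if_neg hi)

theorem sqNorm_eprPairs (k : ℕ) : sqNorm (eprPairs k) = 1 := by
  simp only [sqNorm, eprPairs_apply, Fintype.sum_prod_type]
  have : ∀ x y : Fin k → Fin 2, ‖if x = y then (((1 / √2) ^ k : ℝ) : ℂ) else 0‖ ^ 2
      = if x = y then (1 / 2 : ℝ) ^ k else 0 := fun x y => by
    split_ifs
    · rw [Complex.norm_real, Real.norm_eq_abs, sq_abs, ← pow_mul, mul_comm k, pow_mul]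
      congr 1
      rw [div_pow, Real.sq_sqrt (by norm_num)]; norm_num
    · simp
  simp only [this, Finset.sum_ite_eq, Finset.mem_univ, if_true]
  simp

/-- The state `|00⟩|00⟩` and the basis states with all four labels nonzero are distinct basis
states, so their weights add up to at most the total. The labels are grouped by party: `l` is
Alice's pair of system and reference, `l'` Bob's. -/
theorem sum_prod_fin_succ_ge (d : ℕ) {f : (Fin (d + 1) × Fin (d + 1)) × (Fin (d + 1) × Fin (d + 1)) → ℝ}
    (hf : ∀ p, 0 ≤ f p) :
    f ((0, 0), (0, 0)) + ∑ l : Fin d × Fin d, ∑ l' : Fin d × Fin d,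
      f ((l.2.succ, l'.2.succ), (l.1.succ, l'.1.succ)) ≤ ∑ p, f p := by
  let e : Option ((Fin d × Fin d) × (Fin d × Fin d)) →
      (Fin (d + 1) × Fin (d + 1)) × (Fin (d + 1) × Fin (d + 1)) := fun o =>
    o.elim ((0, 0), (0, 0)) fun x => ((x.1.2.succ, x.2.2.succ), (x.1.1.succ, x.2.1.succ))
  have he : Function.Injective e := by
    rintro (_ | ⟨⟨a, b⟩, ⟨a', b'⟩⟩) (_ | ⟨⟨x, y⟩, ⟨x', y'⟩⟩) h <;>
      simp_all [e, Fin.succ_ne_zero, (Fin.succ_ne_zero _).symm]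
  calc _ = ∑ o, f (e o) := by
        rw [Fintype.sum_option, Fintype.sum_prod_type (γ := ℝ) (fun x => f (e (some x)))]; rfl
    _ = ∑ p ∈ Finset.univ.map ⟨e, he⟩, f p := by rw [Finset.sum_map]; rfl
    _ ≤ _ := Finset.sum_le_univ_sum_of_nonneg hf

/-! ### The test input and its amplitudes. -/

/-- The test input: a maximally entangled state of Schmidt rank `2 * d` shared by the two parties,
each of whom also holds half of the reference system. -/
def testInput (d : ℕ) (r : Fin (d + 1) × Fin (d + 1)) : Fin (d + 1) × Fin (d + 1) → ℂ :=
  (((1 / √2 : ℝ) : ℂ) * ketPhi d r) • ketZero d + (((1 / √2 : ℝ) : ℂ) * ketZero d r) • ketPhi d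

theorem sq_one_div_sqrt_two : (1 / √2 : ℝ) ^ 2 = 1 / 2 := by
  rw [div_pow, Real.sq_sqrt (by norm_num)]; norm_num

theorem sum_sqNorm_testInput {d : ℕ} (hd : 1 ≤ d) : ∑ r, sqNorm (testInput d r) = 1 := by
  have h1 := sqNorm_ketZero hd
  have h2 := sqNorm_ketPhi hd
  simp only [sqNorm] at h1 h2
  simp only [testInput, sqNorm_ket_combination hd, norm_mul, mul_pow, Complex.norm_real,
    Real.norm_eq_abs, sq_abs, sq_one_div_sqrt_two, Finset.sum_add_distrib, ← Finset.mul_sum, h1, h2]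
  norm_num

theorem gate_mulVec_testInput {d : ℕ} (hd : 1 ≤ d) (r : Fin (d + 1) × Fin (d + 1)) :
    gate d *ᵥ testInput d r = (((1 / √2 : ℝ) : ℂ) * ketZero d r) • ketZero d
      + (((1 / √2 : ℝ) : ℂ) * ketPhi d r) • ketPhi d := by
  rw [testInput, gate_mulVec hd, add_comm (_ • ketPhi d)]

theorem sum_sqNorm_gate_mulVec_testInput {d : ℕ} (hd : 1 ≤ d) :
    ∑ r, sqNorm (gate d *ᵥ testInput d r) = 1 := by
  have h1 := sqNorm_ketZero hd
  have h2 := sqNorm_ketPhi hd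
  simp only [sqNorm] at h1 h2
  simp only [gate_mulVec_testInput hd, sqNorm_ket_combination hd, norm_mul, mul_pow,
    Complex.norm_real,
    Real.norm_eq_abs, sq_abs, sq_one_div_sqrt_two, Finset.sum_add_distrib, ← Finset.mul_sum, h1, h2]
  norm_num

/-- The target is `(|00⟩|00⟩ + |Φ⟩|Φ⟩)/√2`, and the second term is uniform over the `d²` labels `l`
on which Alice's and Bob's pairs agree. -/
theorem sum_star_gate_mulVec_testInput {d : ℕ} (hd : 1 ≤ d)
    (G : Fin (d + 1) × Fin (d + 1) → Fin (d + 1) × Fin (d + 1) → ℂ) :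
    ∑ r, star (gate d *ᵥ testInput d r) ⬝ᵥ G r
      = ((1 / √2 : ℝ) : ℂ) * (G (0, 0) (0, 0)
          + (1 / d : ℝ) * ∑ l : Fin d × Fin d, G (l.2.succ, l.2.succ) (l.1.succ, l.1.succ)) := by
  have h : ∀ r, star (gate d *ᵥ testInput d r) ⬝ᵥ G r
      = ((1 / √2 : ℝ) : ℂ) * (ketZero d r * (ketZero d ⬝ᵥ G r) + ketPhi d r * (ketPhi d ⬝ᵥ G r)) :=
    fun r => by
    have e1 := congrFun (star_ketZero d) r
    have e2 := congrFun (star_ketPhi d) r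
    simp only [Pi.star_apply] at e1 e2
    rw [gate_mulVec_testInput hd, star_add, star_smul, star_smul, star_ketZero, star_ketPhi,
      star_mul', star_mul', e1, e2, add_dotProduct, smul_dotProduct, smul_dotProduct]
    simp only [Complex.star_def, Complex.conj_ofReal, smul_eq_mul]
    ring
  have hd' : (0 : ℝ) ≤ d := Nat.cast_nonneg d
  simp only [h, ← Finset.mul_sum, Finset.sum_add_distrib]
  rw [sum_ketZero_mul d fun r => ketZero d ⬝ᵥ G r, sum_ketPhi_mul d fun r => ketPhi d ⬝ᵥ G r]
  simp only [dotProduct, sum_ketZero_mul, sum_ketPhi_mul]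
  rw [← Finset.mul_sum, ← mul_assoc, ← Complex.ofReal_mul, div_mul_div_comm, Real.mul_self_sqrt hd',
    one_mul, Fintype.sum_prod_type_right]

/-- One party's amplitudes for a Kraus operator applied to its half of the test input. -/
def testAmplitude {d : ℕ} {C : Type} (K : Matrix (Fin (d + 1)) (Fin (d + 1) × C) ℂ)
    (p : Fin (d + 1) × Fin (d + 1)) : (Fin d ⊕ Fin d) × C → ℂ
  | (.inl s, c) => if p.2 = s.succ then K p.1 (0, c) else 0
  | (.inr s, c) => if p.2 = 0 then K p.1 (s.succ, c) else 0

/-- The test input with `k` EPR pairs has `2 * d * 2 ^ k` equal Schmidt coefficients. A product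
Kraus operator thus produces amplitudes that are one constant times a bilinear pairing of local
vectors over the Schmidt index. The two summands of `Fin d ⊕ Fin d` are the branches `|Φ⟩_R|00⟩` and
`|00⟩_R|Φ⟩`. -/
theorem kronecker_mulVec_testInput {d k : ℕ}
    (K L : Matrix (Fin (d + 1)) (Fin (d + 1) × (Fin k → Fin 2)) ℂ)
    (r x : Fin (d + 1) × Fin (d + 1)) :
    (((K ⊗ₖ L) * adjoinMatrix (Fin (d + 1)) (Fin (d + 1)) (eprPairs k)) *ᵥ testInput d r) x
      = ((1 / √2 * (1 / √d) * (1 / √2) ^ k : ℝ) : ℂ) *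
        ∑ q, testAmplitude K (x.1, r.1) q * testAmplitude L (x.2, r.2) q := by
  have h1 : (((K ⊗ₖ L) * adjoinMatrix (Fin (d + 1)) (Fin (d + 1)) (eprPairs k)) *ᵥ testInput d r) x
      = ∑ a, testInput d r a * (((1 / √2) ^ k : ℝ) * ∑ c, K x.1 (a.1, c) * L x.2 (a.2, c)) := by
    rw [← Matrix.mulVec_mulVec]
    simp only [Matrix.mulVec, dotProduct, adjoinMatrix, Matrix.of_apply, ite_mul, zero_mul,
      Finset.sum_ite_eq, Finset.mem_univ, if_true, eprPairs_apply, Matrix.kroneckerMap_apply,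
      Fintype.sum_prod_type, mul_ite, mul_zero]
    refine Finset.sum_congr rfl fun a _ => ?_
    rw [Finset.sum_comm]
    refine Finset.sum_congr rfl fun b _ => ?_
    rw [Finset.mul_sum, Finset.mul_sum]
    refine Finset.sum_congr rfl fun c _ => ?_
    ring
  rw [h1]
  simp only [testInput, Pi.add_apply, Pi.smul_apply, smul_eq_mul, add_mul, mul_assoc,
    Finset.sum_add_distrib, ← Finset.mul_sum, sum_ketZero_mul, sum_ketPhi_mul]
  rw [Fintype.sum_prod_type, Fintype.sum_sum_type]
  simp only [testAmplitude]
  have hz : ketZero d r = if r.1 = 0 ∧ r.2 = 0 then 1 else 0 := by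
    simp [ketZero, Pi.single_apply, Prod.ext_iff]
  have e1 : ∑ s : Fin d, ∑ c, (if r.1 = s.succ then K x.1 (0, c) else 0)
      * (if r.2 = s.succ then L x.2 (0, c) else 0)
      = (if r.1 = r.2 ∧ r.1 ≠ 0 then 1 else 0) * ∑ c, K x.1 (0, c) * L x.2 (0, c) := by
    obtain ⟨r1, r2⟩ := r
    refine Fin.cases ?_ (fun s => ?_) r1
    · simp [(Fin.succ_ne_zero _).symm]
    · by_cases h : r2 = s.succ
      · subst h; simp [Fin.succ_inj]
      · rw [if_neg (fun h' => h h'.1.symm), zero_mul]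
        refine Finset.sum_eq_zero fun t _ => Finset.sum_eq_zero fun c _ => ?_
        by_cases hst : s = t
        · subst hst; simp [h]
        · simp [hst]
  have e2 : ∑ s : Fin d, ∑ c, (if r.1 = 0 then K x.1 (s.succ, c) else 0)
      * (if r.2 = 0 then L x.2 (s.succ, c) else 0)
      = ketZero d r * ∑ s : Fin d, ∑ c, K x.1 (s.succ, c) * L x.2 (s.succ, c) := by
    rw [hz]
    by_cases h1 : r.1 = 0 <;> by_cases h2 : r.2 = 0 <;> simp [h1, h2]
  rw [e1, e2]
  simp only [ketPhi]
  split_ifs <;> push_cast <;> ring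

/-- With reference label `0` only the second branch survives, and there the amplitudes are one row
of `K i` restricted to nonzero inputs. They inherit the contraction property. -/
theorem sum_testAmplitude_zero_le {d : ℕ} {C I : Type} [Fintype C] [Fintype I]
    {K : I → Matrix (Fin (d + 1)) (Fin (d + 1) × C) ℂ}
    (hK : ∀ z, ∑ i, sqNorm (K i *ᵥ z) ≤ sqNorm z) (z : (Fin d ⊕ Fin d) × C → ℂ) :
    ∑ i, ‖∑ q, testAmplitude (K i) (0, 0) q * z q‖ ^ 2 ≤ sqNorm z := by
  let y : Fin (d + 1) × C → ℂ := fun p =>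
    Fin.cases (motive := fun _ => ℂ) 0 (fun s => z (.inr s, p.2)) p.1
  have h1 : ∀ i, ∑ q, testAmplitude (K i) (0, 0) q * z q = (K i *ᵥ y) 0 := fun i => by
    simp only [Fintype.sum_prod_type, Fintype.sum_sum_type, testAmplitude, Matrix.mulVec,
      dotProduct, Fin.sum_univ_succ (n := d), y, (Fin.succ_ne_zero _).symm]
    simp
  have h2 : sqNorm y ≤ sqNorm z := by
    simp only [sqNorm, Fintype.sum_prod_type, Fintype.sum_sum_type, Fin.sum_univ_succ (n := d), y]
    simp only [Fin.cases_zero, Fin.cases_succ, norm_zero]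
    simp only [ne_eq, OfNat.ofNat_ne_zero, not_false_eq_true, zero_pow, Finset.sum_const_zero]
    gcongr
    positivity
  refine le_trans (Finset.sum_le_sum fun i _ => ?_) ((hK y).trans h2)
  rw [h1]
  exact Finset.single_le_sum (f := fun x => ‖(K i *ᵥ y) x‖ ^ 2) (fun x _ => sq_nonneg _)
    (Finset.mem_univ 0)

/-! ### The lower bound. -/

/-- The weights of the two branches of the test output and their coherence, for a simulation with
`c` bits and EPR pairs. -/
theorem Simulates.exists_weights {d k c : ℕ} (hd : 1 ≤ d) {ε : ℝ} (hε : 0 ≤ ε)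
    (h : Simulates (eprPairs k) c (gate d) ε) :
    ∃ a b q S : ℝ, 0 ≤ a ∧ 0 ≤ b ∧ b ≤ q ∧ a + q ≤ 1 ∧ 1 - ε ≤ (a + b) / 2 + S ∧
      S ^ 2 ≤ a * b ∧ S ^ 2 ≤ 2 ^ c * q / (d : ℝ) ^ 2 := by
  obtain ⟨N, hN, hdiam⟩ := h
  obtain ⟨M, _, I, J, _, _, K, L, hcard, hKr, hK, hL, hTP⟩ := hN.hasProductKraus
  let X (t : Σ m, I m × J m) : Matrix (Fin (d + 1) × Fin (d + 1)) (Fin (d + 1) × Fin (d + 1)) ℂ :=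
    (K t.1 t.2.1 ⊗ₖ L t.1 t.2.2) * adjoinMatrix (Fin (d + 1)) (Fin (d + 1)) (eprPairs k)
  have hNX : N ∘ₗ adjoinState _ _ (eprPairs k) = krausMap X := by
    ext1 ρ
    rw [LinearMap.comp_apply, adjoinState_apply, hKr, krausMap_apply, Fintype.sum_sigma]
    refine Finset.sum_congr rfl fun m _ => ?_
    rw [Fintype.sum_prod_type]
    refine Finset.sum_congr rfl fun i _ => Finset.sum_congr rfl fun j _ => ?_
    simp only [X, Matrix.conjTranspose_mul, Matrix.mul_assoc]
  rw [hNX] at hdiam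
  have hfid := one_sub_le_fidelity X (gate d) hε hdiam (testInput d) (sum_sqNorm_testInput hd)
    (sum_sqNorm_gate_mulVec_testInput hd)
  have hd0 : (0 : ℝ) < d := by exact_mod_cast hd
  let G (t : Σ m, I m × J m) (r : Fin (d + 1) × Fin (d + 1)) : Fin (d + 1) × Fin (d + 1) → ℂ :=
    X t *ᵥ testInput d r
  let α (t : Σ m, I m × J m) : ℂ := G t (0, 0) (0, 0)
  let β (t : Σ m, I m × J m) : ℂ :=
    (1 / d : ℝ) * ∑ l : Fin d × Fin d, G t (l.2.succ, l.2.succ) (l.1.succ, l.1.succ)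
  -- The weight of the whole block, including `l ≠ l'`. It dominates `‖β t‖²`, and it is the
  -- Hilbert-Schmidt norm that the overlap bound requires.
  let Q (t : Σ m, I m × J m) : ℝ := ∑ l : Fin d × Fin d, ∑ l' : Fin d × Fin d,
    ‖G t (l.2.succ, l'.2.succ) (l.1.succ, l'.1.succ)‖ ^ 2
  have hβQ : ∀ t, ‖β t‖ ^ 2 ≤ Q t := fun t => by
    have h1 : ‖∑ l : Fin d × Fin d, G t (l.2.succ, l.2.succ) (l.1.succ, l.1.succ)‖ ^ 2
        ≤ d ^ 2 * Q t := by
      calc _ ≤ sqNorm (fun _ : Fin d × Fin d => (1 : ℂ)) * sqNorm (fun l : Fin d × Fin d =>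
              G t (l.2.succ, l.2.succ) (l.1.succ, l.1.succ)) := by
            simpa using norm_sum_mul_sq_le (fun _ : Fin d × Fin d => (1 : ℂ)) fun l =>
              G t (l.2.succ, l.2.succ) (l.1.succ, l.1.succ)
        _ ≤ _ := by
          have e : sqNorm (fun _ : Fin d × Fin d => (1 : ℂ)) = (d : ℝ) ^ 2 := by
            simp [sqNorm, sq]
          rw [e]
          gcongr
          exact Finset.sum_le_sum fun l _ => Finset.single_le_sum
            (f := fun l' : Fin d × Fin d => ‖G t (l.2.succ, l'.2.succ) (l.1.succ, l'.1.succ)‖ ^ 2)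
            (fun _ _ => sq_nonneg _) (Finset.mem_univ l)
    rw [norm_mul, mul_pow, Complex.norm_real, Real.norm_eq_abs, sq_abs, div_pow, one_pow,
      one_div_mul_eq_div, div_le_iff₀ (by positivity), mul_comm]
    exact h1
  have hsum : ∑ t, ‖α t‖ ^ 2 + ∑ t, Q t ≤ 1 := by
    rw [← Finset.sum_add_distrib]
    calc _ ≤ ∑ t, ∑ r, sqNorm (G t r) := Finset.sum_le_sum fun t _ => by
          have := sum_prod_fin_succ_ge d (f := fun p => ‖G t p.1 p.2‖ ^ 2) fun _ => sq_nonneg _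
          rw [Fintype.sum_prod_type (fun p : (Fin (d + 1) × Fin (d + 1)) × _ =>
            ‖G t p.1 p.2‖ ^ 2)] at this
          exact this
      _ = ∑ r, sqNorm (testInput d r) := by
          rw [Finset.sum_comm]
          refine Finset.sum_congr rfl fun r _ => ?_
          have := hTP (adjoinMatrix _ _ (eprPairs k) *ᵥ testInput d r)
          rw [sqNorm_adjoinMatrix_mulVec, sqNorm_eprPairs, mul_one] at this
          rw [← this, Fintype.sum_sigma]
          refine Finset.sum_congr rfl fun m _ => ?_
          rw [Fintype.sum_prod_type]
          simp only [G, X, Matrix.mulVec_mulVec]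
      _ = 1 := sum_sqNorm_testInput hd
  have hF : 1 - ε ≤ ∑ t, ‖α t + β t‖ ^ 2 / 2 := by
    refine hfid.trans_eq (Finset.sum_congr rfl fun t _ => ?_)
    rw [sum_star_gate_mulVec_testInput hd (G t), norm_mul, mul_pow, Complex.norm_real,
      Real.norm_eq_abs, sq_abs, sq_one_div_sqrt_two]
    ring
  let z : ℂ := ∑ t, star (α t) * β t
  refine ⟨∑ t, ‖α t‖ ^ 2, ∑ t, ‖β t‖ ^ 2, ∑ t, Q t, z.re,
    Finset.sum_nonneg fun _ _ => sq_nonneg _, Finset.sum_nonneg fun _ _ => sq_nonneg _,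
    Finset.sum_le_sum fun t _ => hβQ t, hsum, ?_, ?_, ?_⟩
  · refine hF.trans_eq ?_
    simp only [z, Complex.re_sum]
    rw [← Finset.sum_add_distrib, Finset.sum_div, ← Finset.sum_add_distrib]
    refine Finset.sum_congr rfl fun t _ => ?_
    have h1 : ∀ w : ℂ, ‖w‖ ^ 2 = w.re ^ 2 + w.im ^ 2 := fun w => by
      rw [Complex.sq_norm, Complex.normSq_apply]; ring
    simp only [h1, Complex.add_re, Complex.add_im, Complex.mul_re, Complex.star_def,
      Complex.conj_re, Complex.conj_im]
    ring
  · calc z.re ^ 2 ≤ ‖z‖ ^ 2 := by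
          rw [← sq_abs]; gcongr; exact Complex.abs_re_le_norm z
      _ ≤ sqNorm (star α) * sqNorm β := norm_sum_mul_sq_le _ _
      _ = _ := by rw [sqNorm_star]; rfl
  · have hm : ∀ m, ‖∑ p : I m × J m, star (α ⟨m, p⟩) * β ⟨m, p⟩‖ ^ 2
        ≤ (∑ p : I m × J m, Q ⟨m, p⟩) / d ^ 2 := fun m => by
      let s : ℝ := 1 / √2 * (1 / √d) * (1 / √2) ^ k
      -- The squared Schmidt coefficient times the Schmidt rank is 1. This flatness removes the
      -- number of EPR pairs from the estimate.
      have hs : s ^ 2 * Fintype.card ((Fin d ⊕ Fin d) × (Fin k → Fin 2)) = 1 := by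
        simp only [s, mul_pow, div_pow, one_pow, ← pow_mul, Fintype.card_prod, Fintype.card_sum,
          Fintype.card_fin, Fintype.card_fun, mul_comm k 2]
        rw [Real.sq_sqrt (by norm_num), Real.sq_sqrt hd0.le, pow_mul, Real.sq_sqrt (by norm_num)]
        push_cast
        field_simp
        ring
      have hG : ∀ i j r x, G ⟨m, i, j⟩ r x = (s : ℂ) * ∑ q,
          testAmplitude (K m i) (x.1, r.1) q * testAmplitude (L m j) (x.2, r.2) q :=
        fun i j r x => kronecker_mulVec_testInput _ _ r x
      have hov := norm_overlap_sq_le (fun i => testAmplitude (K m i) (0, 0))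
        (fun j => testAmplitude (L m j) (0, 0)) (sum_testAmplitude_zero_le (hK m))
        (sum_testAmplitude_zero_le (hL m))
        (fun i (l : Fin d × Fin d) => testAmplitude (K m i) (l.1.succ, l.2.succ))
        (fun j (l : Fin d × Fin d) => testAmplitude (L m j) (l.1.succ, l.2.succ))
      set Y := ∑ i, ∑ j, star (∑ x, testAmplitude (K m i) (0, 0) x * testAmplitude (L m j) (0, 0) x)
        * ∑ l : Fin d × Fin d, ∑ x, testAmplitude (K m i) (l.1.succ, l.2.succ) x
          * testAmplitude (L m j) (l.1.succ, l.2.succ) x with hY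
      have e1 : ∑ p : I m × J m, star (α ⟨m, p⟩) * β ⟨m, p⟩ = ((s ^ 2 / d : ℝ) : ℂ) * Y := by
        rw [hY, Fintype.sum_prod_type, Finset.mul_sum]
        refine Finset.sum_congr rfl fun i _ => ?_
        rw [Finset.mul_sum]
        refine Finset.sum_congr rfl fun j _ => ?_
        simp only [α, β, hG, ← Finset.mul_sum, star_mul', Complex.star_def, Complex.conj_ofReal]
        push_cast
        ring
      have e2 : ∑ p : I m × J m, Q ⟨m, p⟩ = s ^ 2 * ∑ i, ∑ j, ∑ l : Fin d × Fin d,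
          ∑ l' : Fin d × Fin d, ‖∑ x, testAmplitude (K m i) (l.1.succ, l.2.succ) x
            * testAmplitude (L m j) (l'.1.succ, l'.2.succ) x‖ ^ 2 := by
        rw [Fintype.sum_prod_type]
        simp only [Q, hG, norm_mul, mul_pow, Complex.norm_real, Real.norm_eq_abs, sq_abs, ← Finset.mul_sum]
      set Z := ∑ i, ∑ j, ∑ l : Fin d × Fin d,
          ∑ l' : Fin d × Fin d, ‖∑ x, testAmplitude (K m i) (l.1.succ, l.2.succ) x
            * testAmplitude (L m j) (l'.1.succ, l'.2.succ) x‖ ^ 2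
      rw [e1, e2, norm_mul, mul_pow, Complex.norm_real, Real.norm_eq_abs, sq_abs]
      calc (s ^ 2 / d) ^ 2 * ‖Y‖ ^ 2 ≤ (s ^ 2 / d) ^ 2 *
            (Fintype.card ((Fin d ⊕ Fin d) × (Fin k → Fin 2)) * Z) := by gcongr
        _ = s ^ 2 * Fintype.card ((Fin d ⊕ Fin d) × (Fin k → Fin 2)) * (s ^ 2 * Z) / d ^ 2 := by
          ring
        _ = _ := by rw [hs, one_mul]
    calc z.re ^ 2 ≤ ‖z‖ ^ 2 := by
          rw [← sq_abs]; gcongr; exact Complex.abs_re_le_norm z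
      _ ≤ (∑ m, ‖∑ p : I m × J m, star (α ⟨m, p⟩) * β ⟨m, p⟩‖) ^ 2 := by
        gcongr
        simp only [z, Fintype.sum_sigma]
        exact norm_sum_le _ _
      -- The only place where the amount of communication enters: Cauchy-Schwarz over the `2 ^ c`
      -- transcripts.
      _ ≤ Fintype.card M * ∑ m, ‖∑ p : I m × J m, star (α ⟨m, p⟩) * β ⟨m, p⟩‖ ^ 2 :=
        sq_sum_le_card_mul_sum_sq
      _ ≤ Fintype.card M * ∑ m, (∑ p : I m × J m, Q ⟨m, p⟩) / d ^ 2 := by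
        gcongr with m; exact hm m
      _ = _ := by
        rw [hcard, ← Finset.sum_div, Fintype.sum_sigma]
        push_cast
        ring

/-- Since `a + b ≤ 1`, the coherence satisfies `S ≥ 1/2 - ε`. Then `S² ≤ (1 - q) q` confines `q` to
a neighbourhood of `1/2`, and `R ≥ S² / q`. -/
theorem weight_bound {ε δ a b q S R : ℝ} (hε : 0 ≤ ε) (hδ0 : 0 ≤ δ) (hδ : δ < 1 / 2)
    (hεδ : 4 * ε = δ ^ 8) (ha : 0 ≤ a) (hbq : b ≤ q) (haq : a + q ≤ 1)
    (hF : 1 - ε ≤ (a + b) / 2 + S) (hS : S ^ 2 ≤ a * b) (hR : S ^ 2 ≤ R * q) :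
    (1 - 2 * δ) * (1 - δ) ^ 2 / 2 ≤ R := by
  have hδ4 : δ ^ 4 ≤ 1 / 16 := by
    calc δ ^ 4 ≤ (1 / 2) ^ 4 := by gcongr
      _ = 1 / 16 := by norm_num
  have hδ40 : 0 ≤ δ ^ 4 := by positivity
  have hδ8 : δ ^ 8 = δ ^ 4 * δ ^ 4 := by ring
  have hδ41 : δ ^ 4 ≤ δ / 8 := by
    have : δ ^ 3 ≤ (1 / 2) ^ 3 := by gcongr
    nlinarith
  have hε1 : ε ≤ 1 / 1024 := by nlinarith
  have hSε : 1 / 2 - ε ≤ S := by linarith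
  have hS2 : (1 / 2 - ε) ^ 2 ≤ S ^ 2 := by gcongr; linarith
  have hq1 : S ^ 2 ≤ (1 - q) * q := by
    have h1 : a * b ≤ a * q := by gcongr
    have hq0 : 0 ≤ q := by
      by_contra hq
      push Not at hq
      nlinarith
    nlinarith
  -- Completing the square: `(q - 1/2)² ≤ 1/4 - (1/2 - ε)² ≤ ε = (δ ^ 4 / 2)²`.
  have hq2 : q ≤ 1 / 2 + δ ^ 4 / 2 := by
    have h1 : (q - 1 / 2) ^ 2 ≤ (δ ^ 4 / 2) ^ 2 := by nlinarith
    have := abs_le_of_sq_le_sq h1 (by positivity)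
    linarith [(abs_le.mp this).2]
  have hqpos : 0 < q := by
    by_contra hq
    push Not at hq
    nlinarith
  have hRpos : 0 < R := by
    by_contra hR'
    push Not at hR'
    nlinarith
  have h2 : (1 / 2 - ε) ^ 2 ≤ R * (1 / 2 + δ ^ 4 / 2) := by
    calc _ ≤ R * q := hS2.trans hR
      _ ≤ _ := by gcongr
  have h3 : (1 - δ) ^ 2 ≤ (1 - 2 * ε) ^ 2 := by
    gcongr
    · linarith
    · nlinarith
  -- The factor `1 - 2δ` only serves to absorb `1 / (1 + δ ^ 4)`, with much to spare.
  have h4 : (1 - 2 * δ) * (1 + δ ^ 4) ≤ 1 := by nlinarith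
  by_contra hlt
  push Not at hlt
  have h5 : R * (1 + δ ^ 4) < (1 - 2 * δ) * (1 - δ) ^ 2 / 2 * (1 + δ ^ 4) := by gcongr
  have h6 : (1 - 2 * δ) * (1 - δ) ^ 2 / 2 * (1 + δ ^ 4) ≤ (1 - δ) ^ 2 / 2 := by
    have : 0 ≤ (1 - δ) ^ 2 / 2 := by positivity
    nlinarith
  nlinarith

theorem Simulates.le_cost {d k c : ℕ} (hd : 1 ≤ d) {ε δ : ℝ} (hε : 0 ≤ ε)
    (hδ : δ = (4 * ε) ^ (1 / 8 : ℝ)) (hδ2 : δ < 1 / 2)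
    (h : Simulates (eprPairs k) c (gate d) ε) :
    2 * Real.logb 2 d - 1 + Real.logb 2 ((1 - 2 * δ) * (1 - δ) ^ 2) ≤ c := by
  obtain ⟨a, b, q, S, ha, _, hbq, haq, hF, hS, hS'⟩ := h.exists_weights hd hε
  have hδ0 : 0 ≤ δ := by rw [hδ]; positivity
  have hδ8 : 4 * ε = δ ^ 8 := by
    rw [hδ, ← Real.rpow_natCast, ← Real.rpow_mul (by positivity)]
    norm_num
  have hd0 : (0 : ℝ) < d := by exact_mod_cast hd
  have hw := weight_bound (R := 2 ^ c / (d : ℝ) ^ 2) hε hδ0 hδ2 hδ8 ha hbq haq hF hS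
    (hS'.trans_eq (by ring))
  have hpos : 0 < (1 - 2 * δ) * (1 - δ) ^ 2 :=
    mul_pos (by linarith) (pow_pos (by linarith) 2)
  have h1 : (d : ℝ) ^ 2 * ((1 - 2 * δ) * (1 - δ) ^ 2) / 2 ≤ 2 ^ c := by
    rw [le_div_iff₀ (by positivity)] at hw
    linarith
  have h2 := Real.logb_le_logb_of_le (b := 2) (by norm_num) (by positivity) h1
  rw [Real.logb_div (by positivity) (by norm_num), Real.logb_mul (by positivity) hpos.ne',
    Real.logb_pow, Real.logb_pow, Real.logb_self_eq_one (by norm_num)] at h2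
  push_cast at h2
  linarith

theorem le_simCostEPR {d : ℕ} (hd : 1 ≤ d) {ε δ : ℝ} (hε : 0 ≤ ε)
    (hδ : δ = (4 * ε) ^ (1 / 8 : ℝ)) (hδ2 : δ < 1 / 2) :
    ((2 * Real.logb 2 (d : ℝ) - 1 + Real.logb 2 ((1 - 2 * δ) * (1 - δ) ^ 2) : ℝ) : EReal)
      ≤ simCostEPR (gate d) ε :=
  le_iInf fun c => le_iInf fun ⟨_, hk⟩ => by exact_mod_cast hk.le_cost hd hε hδ hδ2

theorem two_mul_logb_succ_le {d : ℕ} (hd : 1 ≤ d) :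
    2 * Real.logb 2 ((d : ℝ) + 1) - 3 ≤ 2 * Real.logb 2 (d : ℝ) - 1 := by
  have hd1 : (1 : ℝ) ≤ d := by exact_mod_cast hd
  have h := Real.logb_le_logb_of_le (b := 2) (by norm_num) (by positivity)
    (show (d : ℝ) + 1 ≤ 2 * d by linarith)
  rw [Real.logb_mul (by norm_num) (by positivity), Real.logb_self_eq_one (by norm_num)] at h
  linarith

/-! ### An upper bound on the diamond distance of two Kraus maps -/

open scoped MatrixOrder in
theorem exists_eq_sum_vecMulVec {X : Type} [Fintype X] [DecidableEq X] {ψ : Matrix X X ℂ}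
    (hψ : ψ.PosSemidef) : ∃ s : X → X → ℂ, ψ = ∑ c, Matrix.vecMulVec (s c) (star (s c)) := by
  obtain ⟨B, rfl⟩ := CStarAlgebra.nonneg_iff_eq_star_mul_self.mp hψ.nonneg
  refine ⟨fun c x => star (B c x), ?_⟩
  ext x y
  simp [Matrix.mul_apply, Matrix.star_eq_conjTranspose, Matrix.sum_apply, Matrix.vecMulVec_apply]

theorem sqNorm_one_kronecker_mulVec {R X Y : Type} [Fintype R] [DecidableEq R] [Fintype X]
    [Fintype Y] (K : Matrix Y X ℂ) (z : R × X → ℂ) :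
    sqNorm (((1 : Matrix R R ℂ) ⊗ₖ K) *ᵥ z) = ∑ r, sqNorm (K *ᵥ fun x => z (r, x)) := by
  rw [sqNorm, Fintype.sum_prod_type]
  refine Finset.sum_congr rfl fun r _ => Finset.sum_congr rfl fun y _ => ?_
  rw [one_kronecker_mulVec K (fun r x => z (r, x)) (r, y)]

theorem sqNorm_add_le {X : Type*} [Fintype X] (y z : X → ℂ) :
    sqNorm (y + z) ≤ 2 * sqNorm y + 2 * sqNorm z := by
  simp only [sqNorm, Finset.mul_sum, ← Finset.sum_add_distrib, Pi.add_apply]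
  refine Finset.sum_le_sum fun x _ => ?_
  have := norm_add_le (y x) (z x)
  have h0 := norm_nonneg (y x + z x)
  nlinarith [sq_nonneg (‖y x‖ - ‖z x‖)]

/-- Write `|p⟩⟨p| - |q⟩⟨q| = |p - q⟩⟨p| + |q⟩⟨p - q|`. The crude bound `2` on the norm of the family
`p` gives `2η + η`. -/
theorem traceNorm_sum_vecMulVec_sub_le {κ X : Type} [Fintype κ] [Fintype X] [DecidableEq X]
    (p q : κ → X → ℂ) {η : ℝ} (hη : 0 ≤ η) (hη1 : η ≤ 1) (hq : ∑ a, sqNorm (q a) ≤ 1)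
    (hpq : ∑ a, sqNorm (p a - q a) ≤ η ^ 2) :
    traceNorm (∑ a, Matrix.vecMulVec (p a) (star (p a))
      - ∑ a, Matrix.vecMulVec (q a) (star (q a))) ≤ 3 * η := by
  have hp : ∑ a, sqNorm (p a) ≤ 2 ^ 2 := by
    calc ∑ a, sqNorm (p a) ≤ ∑ a, (2 * sqNorm (q a) + 2 * sqNorm (p a - q a)) := by
          refine Finset.sum_le_sum fun a _ => ?_
          simpa using sqNorm_add_le (q a) (p a - q a)
      _ ≤ 2 ^ 2 := by
          rw [Finset.sum_add_distrib, ← Finset.mul_sum, ← Finset.mul_sum]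
          nlinarith
  have hM : (∑ a, Matrix.vecMulVec (p a) (star (p a)) - ∑ a, Matrix.vecMulVec (q a) (star (q a)))
      = (∑ a, Matrix.vecMulVec (p a - q a) (star (p a)))
        + ∑ a, Matrix.vecMulVec (q a) (star (p a - q a)) := by
    rw [← Finset.sum_sub_distrib, ← Finset.sum_add_distrib]
    refine Finset.sum_congr rfl fun a _ => ?_
    ext x y
    simp only [Matrix.vecMulVec_apply, Matrix.sub_apply, Matrix.add_apply, Pi.sub_apply,
      Pi.star_apply, star_sub]
    ring
  rw [hM]
  obtain ⟨u, w, hu, hw, htn⟩ := exists_isBessel_traceNorm_eq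
    ((∑ a, Matrix.vecMulVec (p a - q a) (star (p a)))
        + ∑ a, Matrix.vecMulVec (q a) (star (p a - q a)))
  have hsplit := htn
  simp only [Matrix.add_mulVec, dotProduct_add, Finset.sum_add_distrib] at hsplit
  have h1 := norm_sum_isBessel_le hu hw (fun a => p a - q a) p
  have h2 := norm_sum_isBessel_le hu hw q fun a => p a - q a
  have e1 : √(∑ a, sqNorm (p a - q a)) ≤ η := Real.sqrt_le_iff.mpr ⟨hη, hpq⟩
  have e2 : √(∑ a, sqNorm (p a)) ≤ 2 := Real.sqrt_le_iff.mpr ⟨by norm_num, hp⟩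
  have e3 : √(∑ a, sqNorm (q a)) ≤ 1 := Real.sqrt_le_iff.mpr ⟨by norm_num, by simpa using hq⟩
  refine (Real.le_norm_self _).trans ?_
  rw [← Complex.norm_real, hsplit]
  calc _ ≤ η * 2 + 1 * η := (norm_add_le _ _).trans
        (add_le_add (h1.trans (by gcongr)) (h2.trans (by gcongr)))
    _ = 3 * η := by ring

theorem sum_sqNorm_one_kronecker_mulVec_le {ι κ R X Z : Type} [Fintype ι] [Fintype κ] [Fintype R]
    [DecidableEq R] [Fintype X] [Fintype Z] {M : ι → Matrix Z X ℂ} {t : ℝ}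
    (hM : ∀ z, ∑ i, sqNorm (M i *ᵥ z) ≤ t * sqNorm z) (s : κ → R × X → ℂ) :
    ∑ p : ι × κ, sqNorm (((1 : Matrix R R ℂ) ⊗ₖ M p.1) *ᵥ s p.2) ≤ t * ∑ c, sqNorm (s c) := by
  calc _ = ∑ c, ∑ r, ∑ i, sqNorm (M i *ᵥ fun x => s c (r, x)) := by
        rw [Fintype.sum_prod_type_right]
        refine Finset.sum_congr rfl fun c _ => ?_
        rw [Finset.sum_comm]
        exact Finset.sum_congr rfl fun i _ => sqNorm_one_kronecker_mulVec _ _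
    _ ≤ ∑ c, ∑ r, t * sqNorm (fun x => s c (r, x)) :=
        Finset.sum_le_sum fun c _ => Finset.sum_le_sum fun r _ => hM _
    _ = t * ∑ c, sqNorm (s c) := by
        simp only [← Finset.mul_sum]
        congr 1
        refine Finset.sum_congr rfl fun c _ => ?_
        rw [sqNorm, Fintype.sum_prod_type]
        rfl

theorem extend_krausMap_sum_vecMulVec {ι κ R X Z : Type} [Fintype ι] [Fintype κ] [Fintype R]
    [DecidableEq R] [Fintype X] (K : ι → Matrix Z X ℂ) (s : κ → R × X → ℂ) :
    extend R (krausMap K) (∑ c, Matrix.vecMulVec (s c) (star (s c)))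
      = ∑ p : ι × κ, Matrix.vecMulVec (((1 : Matrix R R ℂ) ⊗ₖ K p.1) *ᵥ s p.2)
          (star (((1 : Matrix R R ℂ) ⊗ₖ K p.1) *ᵥ s p.2)) := by
  rw [extend_krausMap, Fintype.sum_prod_type]
  refine Finset.sum_congr rfl fun i _ => ?_
  rw [Matrix.mul_sum, Matrix.sum_mul]
  exact Finset.sum_congr rfl fun c _ => mul_vecMulVec_mul_conjTranspose _ _ _

/-- Kraus families that are close as operators into the dilation give close channels. Decomposing
`ψ` into vectors reduces the claim to two nearby families of output vectors; the reference only adds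
a sum over blocks. -/
theorem diamondNorm_krausMap_sub_le {ι X Z : Type} [Fintype ι] [Fintype X] [Fintype Z]
    [DecidableEq Z] (K K₀ : ι → Matrix Z X ℂ) {η : ℝ} (hη : 0 ≤ η) (hη1 : η ≤ 1)
    (h₀ : ∀ z, ∑ i, sqNorm (K₀ i *ᵥ z) ≤ sqNorm z)
    (hE : ∀ z, ∑ i, sqNorm ((K i - K₀ i) *ᵥ z) ≤ η ^ 2 * sqNorm z) :
    diamondNorm (krausMap K - krausMap K₀) ≤ ENNReal.ofReal (3 * η) := by
  classical
  refine iSup_le fun n => iSup_le fun ψ => iSup_le fun hψ => iSup_le fun htr => ?_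
  refine ENNReal.ofReal_le_ofReal ?_
  obtain ⟨s, rfl⟩ := exists_eq_sum_vecMulVec hψ
  have hs : ∑ c, sqNorm (s c) = 1 := by
    have h : ((∑ c, sqNorm (s c) : ℝ) : ℂ) = 1 := by
      rw [← htr, Matrix.trace_sum]
      push_cast
      refine Finset.sum_congr rfl fun c _ => ?_
      rw [Matrix.trace_vecMulVec, dotProduct_comm, star_dotProduct_self]
    exact_mod_cast h
  rw [extend_sub, extend_krausMap_sum_vecMulVec, extend_krausMap_sum_vecMulVec]
  refine traceNorm_sum_vecMulVec_sub_le _ _ hη hη1 ?_ ?_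
  · simpa [hs] using sum_sqNorm_one_kronecker_mulVec_le (t := 1) (by simpa using h₀) s
  · have := sum_sqNorm_one_kronecker_mulVec_le hE s
    rw [hs, mul_one] at this
    refine le_trans (le_of_eq (Finset.sum_congr rfl fun p _ => ?_)) this
    rw [← Matrix.sub_mulVec]
    congr 2
    ext a b
    simp [Matrix.kroneckerMap_apply, mul_sub]

/-! ### Measurements with many outcomes -/

/-- The operator `1 ⊗ ⟨j|`. -/
def braRight (X : Type) {J : Type} [DecidableEq X] [DecidableEq J] (j : J) : Matrix X (X × J) ℂ :=
  Matrix.of fun x p => if p = (x, j) then 1 else 0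

/-- The operator `∑ j, K j ⊗ |j⟩`. -/
def stack {X J Y : Type} (K : J → Matrix X Y ℂ) : Matrix (X × J) Y ℂ :=
  Matrix.of fun p y => K p.2 p.1 y

theorem braRight_mul_stack {X J Y : Type} [Fintype X] [Fintype J] [DecidableEq X] [DecidableEq J]
    (K : J → Matrix X Y ℂ) (j : J) : braRight X j * stack K = K j := by
  ext x y
  simp [braRight, stack, Matrix.mul_apply]

theorem conjTranspose_stack_mul_stack {X J Y : Type} [Fintype X] [Fintype J]
    (K : J → Matrix X Y ℂ) : (stack K)ᴴ * stack K = ∑ j, (K j)ᴴ * K j := by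
  ext y y'
  simp only [stack, Matrix.mul_apply, Matrix.conjTranspose_apply, Matrix.of_apply,
    Matrix.sum_apply, Fintype.sum_prod_type_right]

theorem sum_conjTranspose_mul_braRight (X J : Type) [Fintype X] [Fintype J] [DecidableEq X]
    [DecidableEq J] : ∑ j : J, (braRight X j)ᴴ * braRight X j = 1 := by
  ext ⟨x, j⟩ ⟨x', j'⟩
  simp only [Matrix.sum_apply, Matrix.mul_apply, Matrix.conjTranspose_apply, braRight,
    Matrix.of_apply, Matrix.one_apply, Prod.mk.injEq, apply_ite star, star_one, star_zero,
    mul_ite, mul_one, mul_zero]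
  rw [← Fintype.sum_prod_type' (f := fun j'' x'' => if x' = x'' ∧ j' = j'' then
    (if x = x'' ∧ j = j'' then (1 : ℂ) else 0) else 0), Finset.sum_eq_single (j', x')]
  · simp
  · rintro ⟨a, b⟩ - h
    rw [if_neg]
    rintro ⟨rfl, rfl⟩
    exact h rfl
  · simp

theorem krausMap_single_comp {X Y Z : Type} [Fintype X] [Fintype Y] (K : Matrix Y X ℂ)
    (L : Matrix Z Y ℂ) :
    krausMap (fun _ : Fin 1 => L) ∘ₗ krausMap (fun _ : Fin 1 => K)
      = krausMap (fun _ : Fin 1 => L * K) := by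
  ext1 ρ
  simp [krausMap_apply, Matrix.mul_assoc]

theorem superop_sum_comp {ι X Y Z : Type} [Fintype ι] (S : ι → Superop Y Z) (T : Superop X Y) :
    (∑ i, S i) ∘ₗ T = ∑ i, S i ∘ₗ T := by
  ext1 ρ
  simp only [LinearMap.comp_apply, LinearMap.sum_apply]

/-- An outcome of `n + 1` bits is sent bit by bit: the first bit is measured and sent, while the
rest of the outcome stays coherent in an ancilla that is measured in later rounds. -/
theorem IsLOCC.alice_instrument {A' B' : Type} [Fintype A'] [Fintype B'] {c : ℕ} (n : ℕ) :
    ∀ {A B A₁ J : Type} [Fintype A] [Fintype B] [Fintype A₁] [Fintype J] [DecidableEq A]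
      [DecidableEq B] [DecidableEq A₁], Fintype.card J = 2 ^ (n + 1) →
      ∀ (K : J → Matrix A₁ A ℂ), ∑ j, (K j)ᴴ * K j = 1 →
      ∀ (N : J → Superop (A₁ × B) (A' × B')), (∀ j, IsLOCC A' B' c A₁ B (N j)) →
      IsLOCC A' B' (c + (n + 1)) A B
        (∑ j, N j ∘ₗ krausMap (fun _ : Fin 1 => K j ⊗ₖ (1 : Matrix B B ℂ))) := by
  induction n with
  | zero =>
    intro A B A₁ J _ _ _ _ _ _ _ hJ K hK N hN
    let e : Bool ≃ J := Fintype.equivOfCardEq (by simp [hJ])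
    have := IsLOCC.aliceSends (c := c) (fun b (_ : Fin 1) => K (e b))
      (by rw [← hK, ← e.sum_comp]; simp) (fun b => N (e b)) fun b => hN (e b)
    rwa [e.sum_comp fun j => N j ∘ₗ krausMap (fun _ : Fin 1 => K j ⊗ₖ (1 : Matrix B B ℂ))] at this
  | succ n ih =>
    intro A B A₁ J _ _ _ _ _ _ _ hJ K hK N hN
    -- The ancilla for the remaining bits. `stack` writes the outcome into it and `braRight` reads
    -- it out, so their product is the original Kraus operator.
    let J' := Fin (2 ^ (n + 1))
    let e : Bool × J' ≃ J := Fintype.equivOfCardEq (by simp [hJ, J']; ring)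
    have h1 : ∀ b, IsLOCC A' B' (c + (n + 1)) (A₁ × J') B (∑ j : J', N (e (b, j)) ∘ₗ
        krausMap (fun _ : Fin 1 => braRight A₁ j ⊗ₖ (1 : Matrix B B ℂ))) := fun b =>
      ih (by simp [J']) _ (sum_conjTranspose_mul_braRight A₁ J') _ fun j => hN _
    have h2 := IsLOCC.aliceSends
      (fun b (_ : Fin 1) => stack fun j => K (e (b, j)))
      (by
        rw [← hK, ← e.sum_comp, Fintype.sum_prod_type]
        refine Finset.sum_congr rfl fun b _ => ?_
        simp only [Finset.univ_unique, Finset.sum_singleton, conjTranspose_stack_mul_stack]) _ h1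
    change IsLOCC A' B' (c + (n + 1) + 1) A B _
    convert h2 using 1
    rw [← e.sum_comp, Fintype.sum_prod_type]
    refine Finset.sum_congr rfl fun b _ => ?_
    rw [superop_sum_comp]
    refine Finset.sum_congr rfl fun j _ => ?_
    rw [LinearMap.comp_assoc, krausMap_single_comp, ← Matrix.mul_kronecker_mul, Matrix.one_mul,
      braRight_mul_stack]

theorem IsLOCC.bob_instrument {A' B' : Type} [Fintype A'] [Fintype B'] {c : ℕ} (n : ℕ) :
    ∀ {A B B₁ J : Type} [Fintype A] [Fintype B] [Fintype B₁] [Fintype J] [DecidableEq A]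
      [DecidableEq B] [DecidableEq B₁], Fintype.card J = 2 ^ (n + 1) →
      ∀ (L : J → Matrix B₁ B ℂ), ∑ j, (L j)ᴴ * L j = 1 →
      ∀ (N : J → Superop (A × B₁) (A' × B')), (∀ j, IsLOCC A' B' c A B₁ (N j)) →
      IsLOCC A' B' (c + (n + 1)) A B
        (∑ j, N j ∘ₗ krausMap (fun _ : Fin 1 => (1 : Matrix A A ℂ) ⊗ₖ L j)) := by
  induction n with
  | zero =>
    intro A B B₁ J _ _ _ _ _ _ _ hJ L hL N hN
    let e : Bool ≃ J := Fintype.equivOfCardEq (by simp [hJ])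
    have := IsLOCC.bobSends (c := c) (fun b (_ : Fin 1) => L (e b))
      (by rw [← hL, ← e.sum_comp]; simp) (fun b => N (e b)) fun b => hN (e b)
    rwa [e.sum_comp fun j => N j ∘ₗ krausMap (fun _ : Fin 1 => (1 : Matrix A A ℂ) ⊗ₖ L j)] at this
  | succ n ih =>
    intro A B B₁ J _ _ _ _ _ _ _ hJ L hL N hN
    let J' := Fin (2 ^ (n + 1))
    let e : Bool × J' ≃ J := Fintype.equivOfCardEq (by simp [hJ, J']; ring)
    have h1 : ∀ b, IsLOCC A' B' (c + (n + 1)) A (B₁ × J') (∑ j : J', N (e (b, j)) ∘ₗ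
        krausMap (fun _ : Fin 1 => (1 : Matrix A A ℂ) ⊗ₖ braRight B₁ j)) := fun b =>
      ih (by simp [J']) _ (sum_conjTranspose_mul_braRight B₁ J') _ fun j => hN _
    have h2 := IsLOCC.bobSends
      (fun b (_ : Fin 1) => stack fun j => L (e (b, j)))
      (by
        rw [← hL, ← e.sum_comp, Fintype.sum_prod_type]
        refine Finset.sum_congr rfl fun b _ => ?_
        simp only [Finset.univ_unique, Finset.sum_singleton, conjTranspose_stack_mul_stack]) _ h1
    change IsLOCC A' B' (c + (n + 1) + 1) A B _
    convert h2 using 1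
    rw [← e.sum_comp, Fintype.sum_prod_type]
    refine Finset.sum_congr rfl fun b _ => ?_
    rw [superop_sum_comp]
    refine Finset.sum_congr rfl fun j _ => ?_
    rw [LinearMap.comp_assoc, krausMap_single_comp, ← Matrix.mul_kronecker_mul, Matrix.one_mul,
      braRight_mul_stack]

/-- Alice measures and announces the outcome `j`, Bob measures depending on `j` and announces the
outcome `k`, and then both discard a subsystem `Y`, Alice after a local operation. -/
theorem IsLOCC.two_rounds {A B X Q Q' R R' J : Type} [Fintype A] [Fintype B] [Fintype X] [Fintype Q]
    [Fintype Q'] [Fintype J] [Fintype R] [Fintype R']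
    [DecidableEq A] [DecidableEq B] [DecidableEq Q] [DecidableEq Q'] {n : ℕ}
    (hJ : Fintype.card J = 2 ^ (n + 1)) (K : J → Matrix Q A ℂ) (hK : ∑ j, (K j)ᴴ * K j = 1)
    (L : J → J → Matrix Q' B ℂ) (hL : ∀ j, ∑ k, (L j k)ᴴ * L j k = 1)
    (F : J → R → Matrix X Q ℂ) (hF : ∀ k, ∑ a, (F k a)ᴴ * F k a = 1)
    (T : R' → Matrix X Q' ℂ) (hT : ∑ b, (T b)ᴴ * T b = 1) :
    IsLOCC X X (n + 1 + (n + 1)) A B (krausMap fun t : J × J × R × R' =>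
      (F t.2.1 t.2.2.1 * K t.1) ⊗ₖ (T t.2.2.2 * L t.1 t.2.1)) := by
  let eR := (Fintype.equivFin R).symm
  let eR' := (Fintype.equivFin R').symm
  have h0 : ∀ k, IsLOCC X X 0 Q Q' (krausMap fun t : Fin _ × Fin _ =>
      F k (eR t.1) ⊗ₖ T (eR' t.2)) := fun k =>
    IsLOCC.finish (fun a => F k (eR a)) (fun b => T (eR' b))
      (by rw [← hF k]; exact eR.sum_comp fun a => (F k a)ᴴ * F k a)
      (by rw [← hT]; exact eR'.sum_comp fun b => (T b)ᴴ * T b)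
  have h1 := fun j => IsLOCC.bob_instrument n hJ (L j) (hL j) _ h0
  have h2 := IsLOCC.alice_instrument n hJ K hK _ h1
  rw [zero_add] at h2
  convert h2 using 1
  ext1 ρ
  simp only [LinearMap.sum_apply, LinearMap.comp_apply, krausMap_apply, Fintype.sum_prod_type,
    Finset.univ_unique, Finset.sum_singleton]
  refine Finset.sum_congr rfl fun j _ => Finset.sum_congr rfl fun k _ => ?_
  rw [← eR.sum_comp]
  refine Finset.sum_congr rfl fun a _ => ?_
  rw [← eR'.sum_comp]
  refine Finset.sum_congr rfl fun b _ => ?_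
  have : (F k (eR a) * K j) ⊗ₖ (T (eR' b) * L j k)
      = (F k (eR a) ⊗ₖ T (eR' b)) * ((1 : Matrix Q Q ℂ) ⊗ₖ L j k) * (K j ⊗ₖ (1 : Matrix B B ℂ)) := by
    rw [← Matrix.mul_kronecker_mul, ← Matrix.mul_kronecker_mul, Matrix.mul_one, Matrix.mul_one]
  rw [this]
  simp only [Matrix.conjTranspose_mul, Matrix.mul_assoc]

/-! ### The shift protocol -/

/-- The discrete Fourier transform. Its entries have equal modulus, so a measurement in this basis
leaves only phases, which the other party can undo. -/
theorem exists_flat_unitary (N : ℕ) [NeZero N] : ∃ H : ZMod N → ZMod N → ℂ,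
    (∀ g g', ∑ j, star (H j g) * H j g' = if g = g' then 1 else 0) ∧
      ∀ j g, H j g * star (H j g) = 1 / N := by
  have hN : (0 : ℝ) < N := by exact_mod_cast Nat.pos_of_ne_zero (NeZero.ne N)
  have hs : ((1 / √(N : ℝ) : ℝ) : ℂ) * ((1 / √(N : ℝ) : ℝ) : ℂ) = 1 / N := by
    rw [← Complex.ofReal_mul, div_mul_div_comm, Real.mul_self_sqrt hN.le]
    push_cast; ring
  refine ⟨fun j g => ((1 / √(N : ℝ) : ℝ) : ℂ) * ZMod.stdAddChar (j * g), fun g g' => ?_,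
    fun j g => ?_⟩
  · have h1 : ∀ j : ZMod N, star (((1 / √(N : ℝ) : ℝ) : ℂ) * ZMod.stdAddChar (j * g))
        * (((1 / √(N : ℝ) : ℝ) : ℂ) * ZMod.stdAddChar (j * g'))
        = (1 / N : ℂ) * ZMod.stdAddChar (j * (g' - g)) := fun j => by
      rw [star_mul', Complex.star_def, ← AddChar.map_neg_eq_conj,
        Complex.conj_ofReal, mul_mul_mul_comm, hs, ← AddChar.map_add_eq_mul]
      congr 2
      ring
    simp only [h1, ← Finset.mul_sum]
    rw [AddChar.sum_mulShift _ (ZMod.isPrimitive_stdAddChar N)]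
    by_cases h : g = g'
    · subst h
      have : (N : ℂ) ≠ 0 := by exact_mod_cast hN.ne'
      simp [ZMod.card, this]
    · rw [if_neg (fun h' => h (sub_eq_zero.mp h').symm), if_neg h]; simp
  · dsimp only
    rw [star_mul', Complex.star_def, ← AddChar.map_neg_eq_conj,
        Complex.conj_ofReal, mul_mul_mul_comm, hs, ← AddChar.map_add_eq_mul]
    simp

/-- The Kraus operator that consumes a register `g` after the permutation `π g` controlled by it,
with amplitude `c g`. -/
def controlled {G X Y : Type} [DecidableEq X] [DecidableEq Y] (π : G → Equiv.Perm (X × Y))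
    (c : G → ℂ) : Matrix (X × Y) (X × (Y × G)) ℂ :=
  Matrix.of fun q p => if π p.2.2 q = (p.1, p.2.1) then c p.2.2 else 0

/-- The relative permutation between register values `g` and `g'` does not depend on the outcome
`s`, so the sum over `s` reaches only the amplitudes, whose orthogonality removes `g ≠ g'`. -/
theorem sum_conjTranspose_mul_controlled {S G X Y : Type} [Fintype S] [Fintype G]
    [Fintype X] [Fintype Y] [DecidableEq G] [DecidableEq X] [DecidableEq Y]
    (π : S → G → Equiv.Perm (X × Y)) (c : S → G → ℂ)
    (hc : ∀ g g', ∑ s, star (c s g) * c s g' = if g = g' then 1 else 0)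
    (σ : G → G → X × Y → X × Y) (hσ : ∀ s g g' p, π s g' ((π s g).symm p) = σ g g' p)
    (hσ0 : ∀ g p, σ g g p = p) :
    ∑ s, (controlled (π s) (c s))ᴴ * controlled (π s) (c s) = 1 := by
  ext ⟨x, y, g⟩ ⟨x', y', g'⟩
  have h1 : ∀ s, ((controlled (π s) (c s))ᴴ * controlled (π s) (c s)) (x, y, g) (x', y', g')
      = if σ g g' (x, y) = (x', y') then star (c s g) * c s g' else 0 := fun s => by
    rw [Matrix.mul_apply, Finset.sum_eq_single ((π s g).symm (x, y))]
    · simp only [controlled, Matrix.conjTranspose_apply, Matrix.of_apply, hσ, hσ0,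
        if_true, mul_ite, mul_zero]
    · intro q _ hq
      have : π s g q ≠ (x, y) := fun h => hq (by rw [← h, Equiv.symm_apply_apply])
      simp [controlled, this]
    · simp
  rw [Matrix.sum_apply, Finset.sum_congr rfl fun s _ => h1 s, Matrix.one_apply]
  by_cases hg : g = g'
  · subst hg
    rw [hσ0]
    by_cases hp : (x, y) = (x', y')
    · have hp' : (x, y, g) = (x', y', g) := by simp_all
      simp only [if_pos hp, if_pos hp', hc, if_true]
    · have hp' : (x, y, g) ≠ (x', y', g) := by simp_all
      simp only [if_neg hp, if_neg hp', Finset.sum_const_zero]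
  · have hp' : (x, y, g) ≠ (x', y', g') := by simp_all
    rw [if_neg hp']
    split_ifs
    · rw [hc, if_neg hg]
    · simp

/-- The Kraus operator that applies the permutation `π` and finds the basis state `a` when the
second subsystem is discarded. -/
def discard {X Y : Type} [DecidableEq X] [DecidableEq Y] (π : Equiv.Perm (X × Y)) (a : Y) :
    Matrix X (X × Y) ℂ :=
  Matrix.of fun x q => if q = π.symm (x, a) then 1 else 0

theorem discard_mul_apply {X Y Z : Type} [Fintype X] [Fintype Y] [DecidableEq X] [DecidableEq Y]
    (π : Equiv.Perm (X × Y)) (a : Y) (K : Matrix (X × Y) Z ℂ) (x : X) (z : Z) :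
    (discard π a * K) x z = K (π.symm (x, a)) z := by
  simp [discard, Matrix.mul_apply]

theorem sum_conjTranspose_mul_discard {X Y : Type} [Fintype X] [Fintype Y] [DecidableEq X]
    [DecidableEq Y] (π : Equiv.Perm (X × Y)) : ∑ a, (discard π a)ᴴ * discard π a = 1 := by
  ext q q'
  simp only [Matrix.sum_apply, Matrix.mul_apply, Matrix.conjTranspose_apply, discard,
    Matrix.of_apply, Matrix.one_apply]
  rw [← Fintype.sum_prod_type' (f := fun a x => star (if q = π.symm (x, a) then (1 : ℂ) else 0)
    * if q' = π.symm (x, a) then 1 else 0), Finset.sum_eq_single ((π q).2, (π q).1)]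
  · simp [eq_comm]
  · rintro ⟨a, x⟩ - h
    have : q ≠ π.symm (x, a) := by
      rintro rfl
      simp at h
    simp [this]
  · simp

/-- The catalyst together with a maximally entangled register indexed by `G`. -/
def registerState {Y G : Type} [Fintype G] [DecidableEq G] (v : Y → Y → ℂ)
    (p : (Y × G) × (Y × G)) : ℂ :=
  if p.1.2 = p.2.2 then ((1 / √(Fintype.card G : ℝ) : ℝ) : ℂ) * v p.1.1 p.2.1 else 0

theorem sum_norm_sq_registerState {Y G : Type} [Fintype Y] [Fintype G] [Nonempty G] [DecidableEq G]
    (v : Y → Y → ℂ) (hv : ∑ y, ∑ y', ‖v y y'‖ ^ 2 = 1) :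
    ∑ p, ‖registerState (G := G) v p‖ ^ 2 = 1 := by
  have hN : (0 : ℝ) < Fintype.card G := by exact_mod_cast Fintype.card_pos
  have h1 : ∀ y g y' g', ‖registerState (G := G) v ((y, g), (y', g'))‖ ^ 2
      = if g = g' then 1 / (Fintype.card G : ℝ) * ‖v y y'‖ ^ 2 else 0 := fun y g y' g' => by
    simp only [registerState]
    split_ifs
    · rw [norm_mul, mul_pow, Complex.norm_real, Real.norm_eq_abs, sq_abs, div_pow,
        Real.sq_sqrt hN.le, one_pow]
    · simp
  simp only [Fintype.sum_prod_type, h1, Finset.sum_ite_eq, Finset.mem_univ, if_true]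
  simp only [Finset.sum_const, Finset.card_univ, nsmul_eq_mul, ← Finset.mul_sum]
  rw [hv]
  field_simp

/-- The result of shifting coherently, reflecting about the uniform superposition of all shifts, and
shifting back, when `a` and `b` are found upon discarding the catalyst. -/
def reflectKraus {G X Y : Type} [Fintype G] [DecidableEq X] (τ : G → Equiv.Perm (X × Y))
    (v : Y → Y → ℂ) (ab : Y × Y) : Matrix (X × X) (X × X) ℂ :=
  let s (z : X × X) (q q' : X × Y) : ℂ := if (q.1, q'.1) = z then v q.2 q'.2 else 0
  Matrix.of fun x z => s z (x.1, ab.1) (x.2, ab.2)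
    - (2 / Fintype.card G : ℂ) * ∑ g, s z (τ g (x.1, ab.1)) (τ g (x.2, ab.2))

/-- Alice shifts under control of her register and measures it in the basis `H`. Bob corrects the
resulting phase, shifts, and measures his register in the reflected basis `R`. Outcome `k` leaves
the shifts by `g - k` weighted with `R k g`, once Alice has compensated for `k`. -/
theorem exists_isLOCC_reflectKraus {n : ℕ} {G X Y : Type} [Fintype X] [Fintype Y]
    [DecidableEq X] [DecidableEq Y] [Fintype G] [DecidableEq G] [AddCommGroup G]
    (hcardG : Fintype.card G = 2 ^ (n + 1)) (τ : G → Equiv.Perm (X × Y))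
    (hτ : ∀ g h q, τ (g + h) q = τ g (τ h q)) (v : Y → Y → ℂ) (H : G → G → ℂ)
    (hH : ∀ g g', ∑ j, star (H j g) * H j g' = if g = g' then 1 else 0)
    (hflat : ∀ j g, H j g * star (H j g) = 1 / Fintype.card G) :
    ∃ N, IsLOCC X X (n + 1 + (n + 1)) (X × (Y × G)) (X × (Y × G)) N ∧
      N ∘ₗ adjoinState X X (registerState (G := G) v) = krausMap (reflectKraus τ v) := by
  set D : ℂ := (Fintype.card G : ℂ) with hD
  have hD0 : D ≠ 0 := by rw [hD, hcardG]; positivity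
  have hN : (0 : ℝ) < Fintype.card G := by exact_mod_cast Fintype.card_pos
  have hτ0 : ∀ q, τ 0 q = q := fun q => by
    have := hτ 0 0 q
    rw [add_zero] at this
    exact ((τ 0).injective this).symm
  have hτs : ∀ g q, (τ g).symm q = τ (-g) q := fun g q => by
    rw [Equiv.symm_apply_eq, ← hτ, add_neg_cancel, hτ0]
  let ν : ℂ := ((√(Fintype.card G : ℝ) : ℝ) : ℂ)
  have hν : ν * ν = D := by
    simp only [ν]
    rw [← Complex.ofReal_mul, Real.mul_self_sqrt hN.le, hD]; simp
  have hνs : star ν = ν := by simp [ν]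
  -- The reflection about the uniform vector of `ℂ^G`: real and orthogonal, and a function of `g -
  -- k` only.
  let R (k g : G) : ℂ := (if k = g then 1 else 0) - 2 / D
  have hR : ∀ g g', ∑ k, R k g * R k g' = if g = g' then 1 else 0 := fun g g' => by
    have : ∀ k, R k g * R k g' = (if k = g then (if g = g' then 1 else 0) else 0)
        - 2 / D * (if k = g then 1 else 0) - 2 / D * (if k = g' then 1 else 0) + 4 / D ^ 2 :=
      fun k => by
        simp only [R]
        by_cases h1 : k = g
        · subst h1; split_ifs <;> field_simp <;> ring
        · split_ifs <;> field_simp <;> ring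
    simp only [this, Finset.sum_add_distrib, Finset.sum_sub_distrib, ← Finset.mul_sum,
      Finset.sum_ite_eq', Finset.mem_univ, if_true, Finset.sum_const, Finset.card_univ,
      nsmul_eq_mul, ← hD]
    field_simp
    ring
  have hRs : ∀ k g, star (R k g) = R k g := fun k g => by
    simp only [R, hD, star_sub, star_div₀, apply_ite star, star_one, star_zero]
    simp
  let K (j : G) : Matrix (X × Y) (X × (Y × G)) ℂ := controlled τ (H j)
  -- The factor `ν * star (H j g)` is a pure phase because `H` is flat; it cancels the phase that
  -- Alice's outcome `j` left on the register. Including `k` in the shift spares Bob a correction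
  -- afterwards.
  let L (j k : G) : Matrix (X × Y) (X × (Y × G)) ℂ :=
    controlled (fun g => τ (g - k)) fun g => ν * star (H j g) * R k g
  have hK : ∑ j, (K j)ᴴ * K j = 1 := by
    refine sum_conjTranspose_mul_controlled (fun _ => τ) H hH (fun g g' => τ (g' - g)) ?_ ?_
    · intro _ g g' p
      rw [hτs, ← hτ, sub_eq_add_neg]
    · intro g p
      rw [sub_self, hτ0]
  have hL : ∀ j, ∑ k, (L j k)ᴴ * L j k = 1 := fun j => by
    refine sum_conjTranspose_mul_controlled (fun k g => τ (g - k))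
      (fun k g => ν * star (H j g) * R k g) ?_ (fun g g' => τ (g' - g)) ?_ ?_
    · intro g g'
      have : ∀ k, star (ν * star (H j g) * R k g) * (ν * star (H j g') * R k g')
          = D * (H j g * star (H j g')) * (R k g * R k g') := fun k => by
        rw [star_mul', star_mul', star_star, hνs, hRs, ← hν]; ring
      simp only [this, ← Finset.mul_sum, hR]
      split_ifs with h
      · subst h
        rw [hflat]; field_simp
      · simp
    · intro k g g' p
      rw [hτs, ← hτ]; congr 2; abel
    · intro g p
      rw [sub_self, hτ0]
  refine ⟨_, IsLOCC.two_rounds hcardG K hK L hL (fun k a => discard (τ k) a)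
    (fun k => sum_conjTranspose_mul_discard (τ k)) (fun b => discard (Equiv.refl (X × Y)) b)
    (sum_conjTranspose_mul_discard _), ?_⟩
  -- All `N²` outcomes `(j, k)` induce the same operator up to the factor `1 / D`, so the messages
  -- carry no information about the input.
  have hop : ∀ j k a b, ((discard (τ k) a * K j) ⊗ₖ (discard (Equiv.refl (X × Y)) b * L j k))
        * adjoinMatrix X X (registerState (G := G) v)
      = (1 / D) • reflectKraus τ v (a, b) := by
    intro j k a b
    ext ⟨x, x'⟩ ⟨z, z'⟩
    let s (q q' : X × Y) : ℂ := if (q.1, q'.1) = (z, z') then v q.2 q'.2 else 0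
    have h1 : (((discard (τ k) a * K j) ⊗ₖ (discard (Equiv.refl (X × Y)) b * L j k))
        * adjoinMatrix X X (registerState (G := G) v)) (x, x') (z, z')
        = ∑ g, ∑ y, ∑ y', (discard (τ k) a * K j) x (z, y, g)
          * (discard (Equiv.refl (X × Y)) b * L j k) x' (z', y', g) * (1 / ν * v y y') := by
      simp only [Matrix.mul_apply (M := _ ⊗ₖ _), Matrix.kroneckerMap_apply, adjoinMatrix,
        Matrix.of_apply, registerState, Fintype.sum_prod_type, mul_ite, mul_zero, Prod.mk.injEq]
      rw [Finset.sum_eq_single z]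
      · rw [Finset.sum_comm]
        refine Finset.sum_congr rfl fun g _ => Finset.sum_congr rfl fun y _ => ?_
        rw [Finset.sum_eq_single z']
        · simp [ν]
        · intro w _ hw
          simp [hw]
        · simp
      · intro w _ hw
        simp [hw]
      · simp
    have h2 : ∀ g, ∑ y, ∑ y', (discard (τ k) a * K j) x (z, y, g)
          * (discard (Equiv.refl (X × Y)) b * L j k) x' (z', y', g) * (1 / ν * v y y')
        = 1 / D * (R k g * s (τ (g - k) (x, a)) (τ (g - k) (x', b))) := fun g => by
      simp only [discard_mul_apply, K, L, controlled, Matrix.of_apply, Equiv.refl_symm,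
        Equiv.refl_apply, hτs, ← hτ, ← sub_eq_add_neg]
      set q := τ (g - k) (x, a)
      set q' := τ (g - k) (x', b)
      have hν0 : ν ≠ 0 := fun h => hD0 (by rw [← hν, h, zero_mul])
      have e : H j g * (ν * star (H j g) * R k g) * (1 / ν) = 1 / D * R k g := by
        rw [← hflat j g]; field_simp
      by_cases hz : q.1 = z ∧ q'.1 = z'
      · rw [Finset.sum_eq_single q.2, Finset.sum_eq_single q'.2]
        · have e1 : q = (z, q.2) := Prod.ext hz.1 rfl
          have e2 : q' = (z', q'.2) := Prod.ext hz.2 rfl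
          rw [if_pos e1, if_pos e2]
          simp only [s]
          rw [if_pos (Prod.ext hz.1 hz.2), ← mul_assoc, e]; ring
        · intro y' _ hy'
          rw [if_neg (c := q' = _) (fun h => hy' (by rw [h]))]; simp
        · simp
        · intro y _ hy
          refine Finset.sum_eq_zero fun y' _ => ?_
          rw [if_neg (c := q = _) (fun h => hy (by rw [h]))]; simp
        · simp
      · simp only [s]
        rw [if_neg (fun h => hz (by simpa using h)), mul_zero, mul_zero]
        refine Finset.sum_eq_zero fun y _ => Finset.sum_eq_zero fun y' _ => ?_
        by_cases hq : q = (z, y)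
        · rw [if_neg (c := q' = _) (fun h => hz ⟨by rw [hq], by rw [h]⟩)]; simp
        · rw [if_neg hq]; simp
    rw [h1, Finset.sum_congr rfl fun g _ => h2 g, ← Finset.mul_sum, Matrix.smul_apply, smul_eq_mul]
    congr 1
    simp only [R, sub_mul, ite_mul, one_mul, zero_mul, Finset.sum_sub_distrib, Finset.sum_ite_eq,
      Finset.mem_univ, if_true, sub_self, hτ0, ← Finset.mul_sum]
    have hsum : ∑ i, s (τ (i - k) (x, a)) (τ (i - k) (x', b))
        = ∑ i, s (τ i (x, a)) (τ i (x', b)) :=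
      (Equiv.subRight k).sum_comp fun g => s (τ g (x, a)) (τ g (x', b))
    rw [hsum]
    rfl
  ext1 ρ
  rw [LinearMap.comp_apply, adjoinState_apply, krausMap_apply, krausMap_apply]
  have h1 : ∀ t : G × G × Y × Y, (((discard (τ t.2.1) t.2.2.1 * K t.1)
        ⊗ₖ (discard (Equiv.refl (X × Y)) t.2.2.2 * L t.1 t.2.1))
      * (adjoinMatrix X X (registerState (G := G) v) * ρ
        * (adjoinMatrix X X (registerState (G := G) v))ᴴ)
      * (((discard (τ t.2.1) t.2.2.1 * K t.1)
        ⊗ₖ (discard (Equiv.refl (X × Y)) t.2.2.2 * L t.1 t.2.1)))ᴴ)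
      = (1 / D ^ 2) • (reflectKraus τ v t.2.2 * ρ * (reflectKraus τ v t.2.2)ᴴ) := fun t => by
    have h := hop t.1 t.2.1 t.2.2.1 t.2.2.2
    set M := (discard (τ t.2.1) t.2.2.1 * K t.1)
        ⊗ₖ (discard (Equiv.refl (X × Y)) t.2.2.2 * L t.1 t.2.1)
    set V := adjoinMatrix X X (registerState (G := G) v)
    calc M * (V * ρ * Vᴴ) * Mᴴ = (M * V) * ρ * (M * V)ᴴ := by
          rw [Matrix.conjTranspose_mul]; simp only [Matrix.mul_assoc]
      _ = _ := by
        rw [h, Matrix.conjTranspose_smul, Matrix.smul_mul, Matrix.smul_mul, Matrix.mul_smul,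
          smul_smul]
        congr 1
        simp [hD, sq]
  rw [Finset.sum_congr rfl fun t _ => h1 t, Fintype.sum_prod_type]
  simp only [Fintype.sum_prod_type (α₁ := G), Finset.sum_const, Finset.card_univ,
    ← Finset.smul_sum]
  rw [← Nat.cast_smul_eq_nsmul ℂ, ← Nat.cast_smul_eq_nsmul ℂ, smul_smul, smul_smul, ← hD]
  rw [show D * D * (1 / D ^ 2) = 1 by field_simp, one_smul]

/-! ### Shifted copies and the error of the reflection. -/

/-- The vector `p ⊗ v`, sorted by parties. -/
def tensorVec {X Y : Type} (p : X → X → ℂ) (v : Y → Y → ℂ) (q q' : X × Y) : ℂ :=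
  p q.1 q'.1 * v q.2 q'.2

theorem reflectKraus_mulVec {G X Y : Type} [Fintype G] [Fintype X] [DecidableEq X]
    (τ : G → Equiv.Perm (X × Y)) (v : Y → Y → ℂ) (ab : Y × Y) (ψ : X × X → ℂ) (x : X × X) :
    (reflectKraus τ v ab *ᵥ ψ) x
      = tensorVec (fun a b => ψ (a, b)) v (x.1, ab.1) (x.2, ab.2)
        - (2 / Fintype.card G : ℂ) * ∑ g, tensorVec (fun a b => ψ (a, b)) v (τ g (x.1, ab.1))
            (τ g (x.2, ab.2)) := by
  have h1 : ∀ q q' : X × Y, ∑ z, (if (q.1, q'.1) = z then v q.2 q'.2 else 0) * ψ z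
      = tensorVec (fun a b => ψ (a, b)) v q q' := fun q q' => by
    simp [tensorVec, mul_comm]
  simp only [Matrix.mulVec, dotProduct, reflectKraus, Matrix.of_apply, sub_mul,
    Finset.sum_sub_distrib, mul_assoc, ← Finset.mul_sum, Finset.sum_mul]
  rw [Finset.sum_comm]
  simp only [h1]
  congr 1
  exact h1 (x.1, ab.1) (x.2, ab.2)

theorem sum_norm_sq_tensorVec {X Y : Type} [Fintype X] [Fintype Y] (p : X → X → ℂ)
    (v : Y → Y → ℂ) (hv : ∑ y, ∑ y', ‖v y y'‖ ^ 2 = 1) :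
    ∑ q, ∑ q', ‖tensorVec p v q q'‖ ^ 2 = ∑ x, ∑ x', ‖p x x'‖ ^ 2 := by
  simp only [tensorVec, Fintype.sum_prod_type, norm_mul, mul_pow]
  refine Finset.sum_congr rfl fun x _ => ?_
  rw [Finset.sum_comm]
  refine Finset.sum_congr rfl fun x' _ => ?_
  simp only [← Finset.mul_sum]
  rw [hv, mul_one]

/-- If the shifts of `t` are pairwise orthogonal, then their sum has squared norm `N * ‖t‖²`. -/
theorem sum_norm_sq_sum_shift {G Q : Type} [Fintype G] [AddCommGroup G] [Fintype Q]
    (τ : G → Equiv.Perm Q) (hτ : ∀ g h q, τ (g + h) q = τ g (τ h q)) (t : Q → Q → ℂ)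
    (ht : ∀ g, g ≠ 0 → ∑ q, ∑ q', star (t q q') * t (τ g q) (τ g q') = 0) :
    ∑ q, ∑ q', ‖∑ g, t (τ g q) (τ g q')‖ ^ 2 = Fintype.card G * ∑ q, ∑ q', ‖t q q'‖ ^ 2 := by
  classical
  have hτ0 : ∀ q, τ 0 q = q := fun q => by
    have := hτ 0 0 q
    rw [add_zero] at this
    exact ((τ 0).injective this).symm
  have hsq : ∀ w : ℂ, ((‖w‖ ^ 2 : ℝ) : ℂ) = star w * w := fun w => by
    rw [Complex.star_def, Complex.conj_mul']; norm_cast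
  -- Translation invariance: the Gram matrix of the shifts depends only on `h - g`, hence is a
  -- multiple of the identity.
  have h1 : ∀ g h, ∑ q, ∑ q', star (t (τ g q) (τ g q')) * t (τ h q) (τ h q')
      = if h = g then ((∑ q, ∑ q', ‖t q q'‖ ^ 2 : ℝ) : ℂ) else 0 := fun g h => by
    have e : ∀ q, τ h q = τ (h - g) (τ g q) := fun q => by rw [← hτ, sub_add_cancel]
    have e2 : ∑ q, ∑ q', star (t (τ g q) (τ g q')) * t (τ h q) (τ h q')
        = ∑ q, ∑ q', star (t q q') * t (τ (h - g) q) (τ (h - g) q') := by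
      rw [← Equiv.sum_comp (τ g) fun q => ∑ q', star (t q q') * t (τ (h - g) q) (τ (h - g) q')]
      refine Finset.sum_congr rfl fun q _ => ?_
      rw [← Equiv.sum_comp (τ g) fun q' => star (t (τ g q) q')
        * t (τ (h - g) (τ g q)) (τ (h - g) q')]
      exact Finset.sum_congr rfl fun q' _ => by rw [e, e]
    rw [e2]
    split_ifs with hgh
    · subst hgh
      push_cast
      simp only [sub_self, hτ0, ← hsq, Complex.ofReal_pow]
    · exact ht _ (sub_ne_zero.mpr hgh)
  have h2 : ((∑ q, ∑ q', ‖∑ g, t (τ g q) (τ g q')‖ ^ 2 : ℝ) : ℂ)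
      = ∑ g, ∑ h, ∑ q, ∑ q', star (t (τ g q) (τ g q')) * t (τ h q) (τ h q') := by
    simp only [Complex.ofReal_sum, hsq, star_sum, Finset.sum_mul_sum]
    calc _ = ∑ q, ∑ g, ∑ q', ∑ h, star (t (τ g q) (τ g q')) * t (τ h q) (τ h q') :=
          Finset.sum_congr rfl fun q _ => Finset.sum_comm
      _ = ∑ g, ∑ q, ∑ q', ∑ h, star (t (τ g q) (τ g q')) * t (τ h q) (τ h q') := Finset.sum_comm
      _ = ∑ g, ∑ q, ∑ h, ∑ q', star (t (τ g q) (τ g q')) * t (τ h q) (τ h q') :=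
          Finset.sum_congr rfl fun g _ => Finset.sum_congr rfl fun q _ => Finset.sum_comm
      _ = _ := Finset.sum_congr rfl fun g _ => Finset.sum_comm
  have h3 : ((∑ q, ∑ q', ‖∑ g, t (τ g q) (τ g q')‖ ^ 2 : ℝ) : ℂ)
      = ((Fintype.card G * ∑ q, ∑ q', ‖t q q'‖ ^ 2 : ℝ) : ℂ) := by
    rw [h2]
    simp only [h1, Finset.sum_ite_eq', Finset.mem_univ, if_true, Finset.sum_const, Finset.card_univ,
      nsmul_eq_mul]
    push_cast
    ring
  exact_mod_cast h3

/-- The shift by `g` of registers indexed by `G`, the register `0` being split off. -/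
def shift {G : Type} [AddCommGroup G] [DecidableEq G] (X : Type) (g : G) :
    Equiv.Perm (X × ({h : G // h ≠ 0} → X)) :=
  (Equiv.funSplitAt (0 : G) X).symm.trans
    (((Equiv.subRight g).arrowCongr (Equiv.refl X)).trans (Equiv.funSplitAt (0 : G) X))

/-- All registers together. -/
def joinRegisters {G X : Type} [AddCommGroup G] [DecidableEq G] (q : X × ({h : G // h ≠ 0} → X)) :
    G → X :=
  (Equiv.funSplitAt (0 : G) X).symm q

theorem joinRegisters_shift {G X : Type} [AddCommGroup G] [DecidableEq G] (g : G)
    (q : X × ({h : G // h ≠ 0} → X)) (h : G) :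
    joinRegisters (shift X g q) h = joinRegisters q (h + g) := by
  simp only [joinRegisters, shift, Equiv.trans_apply, Equiv.symm_apply_apply]
  rfl

theorem joinRegisters_zero {G X : Type} [AddCommGroup G] [DecidableEq G]
    (q : X × ({h : G // h ≠ 0} → X)) : joinRegisters q 0 = q.1 := by
  simp [joinRegisters, Equiv.funSplitAt_symm_apply]

theorem joinRegisters_coe {G X : Type} [AddCommGroup G] [DecidableEq G]
    (q : X × ({h : G // h ≠ 0} → X)) (h : {h : G // h ≠ 0}) : joinRegisters q h = q.2 h := by
  simp [joinRegisters, Equiv.funSplitAt_symm_apply, h.2]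

theorem shift_add {G X : Type} [AddCommGroup G] [DecidableEq G] (g h : G)
    (q : X × ({h : G // h ≠ 0} → X)) : shift X (g + h) q = shift X g (shift X h q) := by
  apply (Equiv.funSplitAt (0 : G) X).symm.injective
  ext k
  change joinRegisters _ k = joinRegisters _ k
  rw [joinRegisters_shift, joinRegisters_shift, joinRegisters_shift, add_assoc]

/-- Copies of `v`, one for every nonzero element of `G`. -/
def copies {X : Type} (G : Type) [AddCommGroup G] [Fintype G] [DecidableEq G] (v : X → X → ℂ)
    (y y' : {h : G // h ≠ 0} → X) : ℂ :=
  ∏ h, v (y h) (y' h)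

theorem sum_norm_sq_copies {X : Type} (G : Type) [AddCommGroup G] [Fintype G] [DecidableEq G]
    [Fintype X] (v : X → X → ℂ) (hv : ∑ x, ∑ x', ‖v x x'‖ ^ 2 = 1) :
    ∑ y, ∑ y', ‖copies G v y y'‖ ^ 2 = 1 := by
  classical
  simp only [copies, norm_prod, ← Finset.prod_pow]
  rw [← Fintype.sum_prod_type' (f := fun y y' : {h : G // h ≠ 0} → X =>
      ∏ h, ‖v (y h) (y' h)‖ ^ 2),
    ← (Equiv.arrowProdEquivProdArrow {h : G // h ≠ 0} (fun _ => X) (fun _ => X)).sum_comp]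
  have := Fintype.prod_sum (fun (_ : {h : G // h ≠ 0}) (x : X × X) => ‖v x.1 x.2‖ ^ 2)
  simp only [Fintype.sum_prod_type, hv, Finset.prod_const_one] at this
  rw [this]
  rfl

theorem tensorVec_copies {G X : Type} [AddCommGroup G] [Fintype G] [DecidableEq G]
    (p v : X → X → ℂ) (q q' : X × ({h : G // h ≠ 0} → X)) :
    tensorVec p (copies G v) q q' = p (joinRegisters q 0) (joinRegisters q' 0) *
      ∏ h : {h : G // h ≠ 0}, v (joinRegisters q h) (joinRegisters q' h) := by
  simp only [joinRegisters_zero, joinRegisters_coe]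
  rfl

theorem tensorVec_copies_shift {G X : Type} [AddCommGroup G] [Fintype G] [DecidableEq G]
    (v : X → X → ℂ) (g : G) (q q' : X × ({h : G // h ≠ 0} → X)) :
    tensorVec v (copies G v) (shift X g q) (shift X g q') = tensorVec v (copies G v) q q' := by
  rw [tensorVec_copies, tensorVec_copies,
    ← Fintype.prod_eq_mul_prod_subtype_ne (fun h : G => v (joinRegisters (shift X g q) h)
      (joinRegisters (shift X g q') h)),
    ← Fintype.prod_eq_mul_prod_subtype_ne (fun h : G => v (joinRegisters q h)
      (joinRegisters q' h))]
  simp only [joinRegisters_shift]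
  exact Equiv.prod_comp (Equiv.addRight g) fun h => v (joinRegisters q h) (joinRegisters q' h)

/-- A nontrivial shift moves `p` away from register `0` and puts a copy of `v` there. Orthogonality
of `p` and `v` in that single register then makes the whole vectors orthogonal. -/
theorem exists_tensorVec_shift_eq {G X : Type} [AddCommGroup G] [Fintype G] [DecidableEq G]
    (p v : X → X → ℂ) {g : G} (hg : g ≠ 0) :
    ∃ r : ({h : G // h ≠ 0} → X) → ({h : G // h ≠ 0} → X) → ℂ, ∀ q q',
      tensorVec p (copies G v) (shift X g q) (shift X g q') = tensorVec v r q q' := by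
  have hg' : -g ≠ 0 := neg_ne_zero.mpr hg
  -- The entry at register `0` is a dummy: the product below omits `h = -g`, so it never reads that
  -- entry.
  let f (y : {h : G // h ≠ 0} → X) : G → X := joinRegisters (y ⟨g, hg⟩, y)
  refine ⟨fun y y' => p (y ⟨g, hg⟩) (y' ⟨g, hg⟩) *
    ∏ h ∈ Finset.univ.erase (⟨-g, hg'⟩ : {h : G // h ≠ 0}), v (f y (h + g)) (f y' (h + g)),
    fun q q' => ?_⟩
  have hf : ∀ (q : X × ({h : G // h ≠ 0} → X)) (k : G), k ≠ 0 → f q.2 k = joinRegisters q k :=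
    fun q k hk => by
      have e1 := joinRegisters_coe q ⟨k, hk⟩
      have e2 := joinRegisters_coe (q.2 ⟨g, hg⟩, q.2) ⟨k, hk⟩
      simp only at e1 e2
      rw [e1, ← e2]
  rw [tensorVec_copies]
  simp only [joinRegisters_shift, zero_add, tensorVec]
  have e1 : ∀ q : X × ({h : G // h ≠ 0} → X), joinRegisters q g = q.2 ⟨g, hg⟩ :=
    fun q => joinRegisters_coe q ⟨g, hg⟩
  rw [← Finset.mul_prod_erase Finset.univ
    (fun h : {h : G // h ≠ 0} => v (joinRegisters q (h + g)) (joinRegisters q' (h + g)))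
    (Finset.mem_univ ⟨-g, hg'⟩)]
  simp only [neg_add_cancel, joinRegisters_zero, e1]
  have e2 : ∀ h ∈ Finset.univ.erase (⟨-g, hg'⟩ : {h : G // h ≠ 0}),
      v (joinRegisters q (h + g)) (joinRegisters q' (h + g))
        = v (f q.2 (h + g)) (f q'.2 (h + g)) := fun h hh => by
    have hne : (h : G) + g ≠ 0 := fun h0 =>
      (Finset.mem_erase.mp hh).1 (Subtype.ext (eq_neg_of_add_eq_zero_left h0))
    rw [hf _ _ hne, hf _ _ hne]
  rw [Finset.prod_congr rfl e2]
  ring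

theorem sum_star_tensorVec_mul {X Y : Type} [Fintype X] [Fintype Y] (p p' : X → X → ℂ)
    (v v' : Y → Y → ℂ) (hp : ∑ x, ∑ x', star (p x x') * p' x x' = 0) :
    ∑ q, ∑ q', star (tensorVec p v q q') * tensorVec p' v' q q' = 0 := by
  have : ∑ q, ∑ q', star (tensorVec p v q q') * tensorVec p' v' q q'
      = (∑ x, ∑ x', star (p x x') * p' x x') * ∑ y, ∑ y', star (v y y') * v' y y' := by
    simp only [tensorVec, Fintype.sum_prod_type]
    rw [Finset.sum_mul]
    refine Finset.sum_congr rfl fun x _ => ?_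
    rw [Finset.sum_comm, Finset.sum_mul]
    refine Finset.sum_congr rfl fun x' _ => ?_
    rw [Finset.mul_sum]
    refine Finset.sum_congr rfl fun y _ => ?_
    rw [Finset.mul_sum]
    refine Finset.sum_congr rfl fun y' _ => ?_
    rw [star_mul']
    ring
  rw [this, hp, zero_mul]

/-- The reflection about the hyperplane orthogonal to the unit vector `v`, implemented by shifting
copies of `v`, has error `2 / √N`. -/
theorem sum_sqNorm_reflect_sub_le {G X : Type} [AddCommGroup G] [Fintype G] [DecidableEq G]
    [Fintype X] [DecidableEq X] (v : X × X → ℂ) (hv : sqNorm v = 1)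
    (U : Matrix (X × X) (X × X) ℂ) (hU : ∀ ψ, U *ᵥ ψ = ψ - (2 * (star v ⬝ᵥ ψ)) • v)
    (ψ : X × X → ℂ) :
    ∑ ab : ({h : G // h ≠ 0} → X) × ({h : G // h ≠ 0} → X),
      sqNorm ((reflectKraus (shift X) (copies G fun a b => v (a, b)) ab
        - copies G (fun a b => v (a, b)) ab.1 ab.2 • U) *ᵥ ψ)
      ≤ 4 / Fintype.card G * sqNorm ψ := by
  set w : X → X → ℂ := fun a b => v (a, b) with hw
  have hN : (0 : ℝ) < Fintype.card G := by exact_mod_cast Fintype.card_pos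
  have hNC : (Fintype.card G : ℂ) ≠ 0 := by exact_mod_cast hN.ne'
  have hw1 : ∑ x, ∑ x', ‖w x x'‖ ^ 2 = 1 := by
    rw [← hv, sqNorm, Fintype.sum_prod_type]
  set c := star v ⬝ᵥ ψ with hc
  -- The component of `ψ` orthogonal to `v`; only this component contributes to the error.
  let p : X → X → ℂ := fun a b => ψ (a, b) - c * v (a, b)
  have hpv : ∑ x, ∑ x', star (p x x') * w x x' = 0 := by
    have h1 : star ψ ⬝ᵥ v = star c := by
      rw [hc]; simp [dotProduct, mul_comm]
    have h2 : ∑ x, ∑ x', star (p x x') * w x x' = star ψ ⬝ᵥ v - star c * (star v ⬝ᵥ v) := by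
      simp only [dotProduct, Finset.mul_sum, ← Finset.sum_sub_distrib, Fintype.sum_prod_type]
      refine Finset.sum_congr rfl fun x _ => Finset.sum_congr rfl fun x' _ => ?_
      simp only [p, hw, star_sub, star_mul', Pi.star_apply]
      ring
    rw [h2, h1, star_dotProduct_self, hv]
    simp
  have hpn : ∑ x, ∑ x', ‖p x x'‖ ^ 2 ≤ sqNorm ψ := by
    have h1 : (sqNorm (ψ - c • v) : ℂ) = ((sqNorm ψ - ‖c‖ ^ 2 : ℝ) : ℂ) := by
      have h2 : star ψ ⬝ᵥ v = star c := by
        rw [hc]; simp [dotProduct, mul_comm]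
      rw [← star_dotProduct_self]
      simp only [star_sub, star_smul, sub_dotProduct, dotProduct_sub, smul_dotProduct,
        dotProduct_smul, star_dotProduct_self, hv, h2, ← hc]
      push_cast
      rw [← Complex.conj_mul']
      simp only [smul_eq_mul, Complex.star_def]
      ring
    have h3 : sqNorm (ψ - c • v) = sqNorm ψ - ‖c‖ ^ 2 := by exact_mod_cast h1
    have h4 : ∑ x, ∑ x', ‖p x x'‖ ^ 2 = sqNorm (ψ - c • v) := by
      rw [sqNorm, Fintype.sum_prod_type]; rfl
    rw [h4, h3]
    linarith [sq_nonneg ‖c‖]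
  set t := tensorVec p (copies G w) with ht
  -- On the component along `v` all `N` shifts agree, so the average of the shifts reproduces the
  -- term `-2 c v` of the exact reflection and cancels in the difference.
  have key : ∀ (ab : ({h : G // h ≠ 0} → X) × ({h : G // h ≠ 0} → X)) (x : X × X),
      ((reflectKraus (shift X) (copies G w) ab - copies G w ab.1 ab.2 • U) *ᵥ ψ) x
        = -(2 / Fintype.card G : ℂ) * ∑ g : G, t (shift X g (x.1, ab.1)) (shift X g (x.2, ab.2)) := by
    intro ab x
    have h1 : ∀ q q' : X × ({h : G // h ≠ 0} → X), t q q'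
        = tensorVec (fun a b => ψ (a, b)) (copies G w) q q' - c * tensorVec w (copies G w) q q' :=
      fun q q' => by
        simp only [ht, tensorVec, p, hw]; ring
    rw [Matrix.sub_mulVec, Pi.sub_apply, reflectKraus_mulVec, Matrix.smul_mulVec, hU]
    simp only [h1, tensorVec_copies_shift, Finset.sum_sub_distrib, Finset.sum_const,
      Finset.card_univ, nsmul_eq_mul]
    simp only [Pi.smul_apply, Pi.sub_apply, smul_eq_mul]
    have h2 : tensorVec (fun a b => ψ (a, b)) (copies G w) (x.1, ab.1) (x.2, ab.2)
        = ψ x * copies G w ab.1 ab.2 := rfl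
    have h3 : tensorVec w (copies G w) (x.1, ab.1) (x.2, ab.2) = v x * copies G w ab.1 ab.2 := rfl
    rw [h2, h3]
    field_simp
    ring
  have horth : ∀ g : G, g ≠ 0 → ∑ q, ∑ q', star (t q q') * t (shift X g q) (shift X g q') = 0 :=
    fun g hg => by
      obtain ⟨r, hr⟩ := exists_tensorVec_shift_eq p w hg
      simp only [ht, hr]
      exact sum_star_tensorVec_mul _ _ _ _ hpv
  have hsum := sum_norm_sq_sum_shift (shift X) shift_add t horth
  rw [ht, sum_norm_sq_tensorVec p _ (sum_norm_sq_copies G w hw1), ← ht] at hsum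
  calc _ = ∑ q, ∑ q', ‖-(2 / Fintype.card G : ℂ) * ∑ g, t (shift X g q) (shift X g q')‖ ^ 2 := by
        simp only [sqNorm, key, Fintype.sum_prod_type]
        calc _ = _ := Finset.sum_congr rfl fun a _ => Finset.sum_comm
          _ = _ := Finset.sum_comm
          _ = _ := Finset.sum_congr rfl fun x _ => Finset.sum_congr rfl fun a _ => Finset.sum_comm
    _ = 4 / Fintype.card G * ∑ x, ∑ x', ‖p x x'‖ ^ 2 := by
        simp only [norm_mul, mul_pow, ← Finset.mul_sum, hsum, norm_neg, norm_div, div_pow]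
        simp only [Complex.norm_ofNat, Complex.norm_natCast]
        field_simp
        norm_num
        ring
    _ ≤ _ := by gcongr

/-! ### The gate as a reflection, and the upper bound. -/

/-- The unit vector `(|00⟩ - |Φ⟩) / √2` that `gate d` reflects. -/
def ketMinus (d : ℕ) : Fin (d + 1) × Fin (d + 1) → ℂ :=
  ((1 / √2 : ℝ) : ℂ) • ketZero d + (-((1 / √2 : ℝ) : ℂ)) • ketPhi d

theorem sqNorm_ketMinus {d : ℕ} (hd : 1 ≤ d) : sqNorm (ketMinus d) = 1 := by
  rw [ketMinus, sqNorm_ket_combination hd, norm_neg, Complex.norm_real, Real.norm_eq_abs, sq_abs,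
    sq_one_div_sqrt_two]
  norm_num

/-- Swapping two orthonormal vectors and fixing their orthogonal complement is the reflection that
negates their normalized difference. -/
theorem gate_mulVec_eq_reflection (d : ℕ) (ψ : Fin (d + 1) × Fin (d + 1) → ℂ) :
    gate d *ᵥ ψ = ψ - (2 * (star (ketMinus d) ⬝ᵥ ψ)) • ketMinus d := by
  have hs : ((1 / √2 : ℝ) : ℂ) * ((1 / √2 : ℝ) : ℂ) = 1 / 2 := by
    rw [← sq, ← Complex.ofReal_pow, sq_one_div_sqrt_two]; push_cast; rfl
  simp only [gate, ketBra, ketMinus, Matrix.add_mulVec, Matrix.sub_mulVec,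
    Matrix.vecMulVec_mulVec, star_ketZero, star_ketPhi, star_add, star_smul, add_dotProduct,
    smul_dotProduct, Matrix.one_mulVec, star_neg, Complex.star_def, Complex.conj_ofReal]
  set s := ((1 / √2 : ℝ) : ℂ)
  ext x
  simp only [Pi.add_apply, Pi.sub_apply, Pi.smul_apply, smul_eq_mul,
    MulOpposite.smul_eq_mul_unop, MulOpposite.unop_op]
  linear_combination (2 * (ketZero d ⬝ᵥ ψ - ketPhi d ⬝ᵥ ψ) * (ketZero d x - ketPhi d x)) * hs

theorem krausMap_smul_eq_conjChannel {ι X : Type} [Fintype ι] [Fintype X] (c : ι → ℂ)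
    (hc : ∑ i, ‖c i‖ ^ 2 = 1) (U : Matrix X X ℂ) :
    krausMap (fun i => c i • U) = conjChannel U := by
  ext1 ρ
  have h : ∀ i, (c i • U) * ρ * (c i • U)ᴴ = ((‖c i‖ ^ 2 : ℝ) : ℂ) • (U * ρ * Uᴴ) := fun i => by
    rw [Matrix.conjTranspose_smul, Matrix.smul_mul, Matrix.smul_mul, Matrix.mul_smul, smul_smul,
      Complex.star_def, Complex.mul_conj']
    norm_cast
  rw [conjChannel, krausMap_apply, krausMap_apply, Finset.sum_congr rfl fun i _ => h i,
    ← Finset.sum_smul, ← Complex.ofReal_sum, hc]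
  simp

theorem exists_simulates_gate {d : ℕ} (hd : 1 ≤ d) (n : ℕ) {ε : ℝ} (hε1 : ε ≤ 1) (hε0 : 0 < ε)
    (hn : 36 / ε ^ 2 ≤ 2 ^ (n + 1)) :
    ∃ (C D : Type) (_ : Fintype C) (_ : Fintype D) (_ : DecidableEq C)
      (_ : DecidableEq D) (χ : C × D → ℂ), ∑ p, ‖χ p‖ ^ 2 = 1 ∧
        Simulates χ (n + 1 + (n + 1)) (gate d) ε := by
  let G := ZMod (2 ^ (n + 1))
  let X := Fin (d + 1)
  let v : X → X → ℂ := fun a b => ketMinus d (a, b)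
  have hcard : Fintype.card G = 2 ^ (n + 1) := ZMod.card _
  have hv1 := sqNorm_ketMinus hd
  have hv : ∑ x, ∑ x', ‖v x x'‖ ^ 2 = 1 := by
    rw [← hv1, sqNorm, Fintype.sum_prod_type]
  have hcop := sum_norm_sq_copies G v hv
  obtain ⟨H, hH, hflat⟩ := exists_flat_unitary (2 ^ (n + 1))
  obtain ⟨N, hN, hNK⟩ := exists_isLOCC_reflectKraus (G := G) hcard (shift X) shift_add (copies G v)
    H hH fun j g => by rw [hflat, hcard]
  refine ⟨_, _, inferInstance, inferInstance, inferInstance, inferInstance,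
    registerState (G := G) (copies G v), sum_norm_sq_registerState _ hcop, N, hN, ?_⟩
  have hc1 : ∑ ab : ({h : G // h ≠ 0} → X) × ({h : G // h ≠ 0} → X),
      ‖copies G v ab.1 ab.2‖ ^ 2 = 1 := by
    rw [Fintype.sum_prod_type]; exact hcop
  rw [hNK, ← krausMap_smul_eq_conjChannel (fun ab : ({h : G // h ≠ 0} → X) × _ =>
    copies G v ab.1 ab.2) hc1 (gate d)]
  have hcard' : (Fintype.card G : ℝ) = 2 ^ (n + 1) := by rw [hcard]; push_cast; rfl
  have hE : ∀ z, _ ≤ _ := sum_sqNorm_reflect_sub_le (G := G) (ketMinus d) hv1 (gate d)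
    (gate_mulVec_eq_reflection d)
  -- With `N` shifts the squared vector error is `4 / N`, and the diamond distance is at most three
  -- times the vector error; hence `N ≥ 36 / ε²`.
  have hη : 4 / (Fintype.card G : ℝ) ≤ (ε / 3) ^ 2 := by
    rw [hcard', div_le_iff₀ (by positivity)]
    rw [div_le_iff₀ (by positivity)] at hn
    nlinarith
  have := diamondNorm_krausMap_sub_le (reflectKraus (shift X) (copies G v))
    (fun ab => copies G v ab.1 ab.2 • gate d) (η := ε / 3) (by positivity) (by linarith)
    (fun z => ?_) fun z => (hE z).trans (by gcongr; exact sqNorm_nonneg _)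
  · rwa [show 3 * (ε / 3) = ε by ring] at this
  · simp only [Matrix.smul_mulVec, sqNorm_smul, ← Finset.sum_mul, hc1, one_mul]
    have h1 : (sqNorm (gate d *ᵥ z) : ℂ) = (sqNorm z : ℂ) := by
      have h2 : star z ⬝ᵥ ketMinus d = star (star (ketMinus d) ⬝ᵥ z) :=
        Matrix.star_dotProduct _ _
      rw [gate_mulVec_eq_reflection, ← star_dotProduct_self, ← star_dotProduct_self]
      simp only [star_sub, star_smul, sub_dotProduct, dotProduct_sub, smul_dotProduct,
        dotProduct_smul, star_dotProduct_self (ketMinus d), hv1, h2, smul_eq_mul, star_mul']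
      simp
      ring
    exact le_of_eq (by exact_mod_cast h1)

theorem simCostEnt_gate_le {d : ℕ} (hd : 1 ≤ d) {ε : ℝ} (hε0 : 0 < ε) (hε1 : ε ≤ 1) :
    simCostEnt (gate d) ε ≤ ((24 + 16 * Real.logb 2 (1 / ε) : ℝ) : EReal) := by
  have hlog : 0 ≤ Real.logb 2 (1 / ε) :=
    Real.logb_nonneg (by norm_num) (by rw [le_div_iff₀ hε0]; linarith)
  -- The `6` comes from `2 ^ 6 = 64 ≥ 36`. The resulting cost `2 (n + 1)` is below `16 + 4 log
  -- (1/ε)`, within the claimed bound.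
  set n := ⌈6 + 2 * Real.logb 2 (1 / ε)⌉₊ with hn
  have hn1 : 6 + 2 * Real.logb 2 (1 / ε) ≤ n := Nat.le_ceil _
  have hn2 : (n : ℝ) < 6 + 2 * Real.logb 2 (1 / ε) + 1 := Nat.ceil_lt_add_one (by positivity)
  have hpow : 36 / ε ^ 2 ≤ 2 ^ (n + 1) := by
    have h1 : (2 : ℝ) ^ (6 + 2 * Real.logb 2 (1 / ε)) ≤ 2 ^ (n : ℝ) :=
      Real.rpow_le_rpow_of_exponent_le (by norm_num) hn1
    have h2 : (2 : ℝ) ^ (6 + 2 * Real.logb 2 (1 / ε)) = 64 * (1 / ε) ^ 2 := by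
      rw [Real.rpow_add (by norm_num), mul_comm 2, Real.rpow_mul (by norm_num),
        Real.rpow_logb (by norm_num) (by norm_num) (by positivity)]
      norm_num
    rw [h2, Real.rpow_natCast] at h1
    calc 36 / ε ^ 2 = 36 * (1 / ε) ^ 2 := by rw [div_pow, one_pow]; ring
      _ ≤ 64 * (1 / ε) ^ 2 := by gcongr; norm_num
      _ ≤ 2 ^ n := h1
      _ ≤ 2 ^ (n + 1) := by gcongr <;> norm_num
  refine iInf_le_of_le (n + 1 + (n + 1)) (iInf_le_of_le (exists_simulates_gate hd n hε1 hε0 hpow) ?_)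
  rw [EReal.coe_le_coe_iff]
  push_cast
  linarith

end NonlocalSim

end

theorem mainTheorem3 (d : ℕ) (hd : 1 ≤ d) :
    (∀ ε δ : ℝ, 0 ≤ ε → δ = (4 * ε) ^ (1 / 8 : ℝ) → δ < 1 / 2 →
      ((2 * Real.logb 2 (d : ℝ) - 1 + Real.logb 2 ((1 - 2 * δ) * (1 - δ) ^ 2) : ℝ) : EReal)
          ≤ NonlocalSim.simCostEPR (NonlocalSim.gate d) ε ∧
      ((2 * Real.logb 2 ((d : ℝ) + 1) - 3 + Real.logb 2 ((1 - 2 * δ) * (1 - δ) ^ 2) : ℝ) : EReal)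
          ≤ NonlocalSim.simCostEPR (NonlocalSim.gate d) ε) ∧
    (∀ ε : ℝ, 0 < ε → ε ≤ 1 →
      NonlocalSim.simCostEnt (NonlocalSim.gate d) ε
        ≤ ((24 + 16 * Real.logb 2 (1 / ε) : ℝ) : EReal)) := by
  refine ⟨fun ε δ hε hδ hδ2 => ?_, fun ε hε0 hε1 => NonlocalSim.simCostEnt_gate_le hd hε0 hε1⟩
  have h := NonlocalSim.le_simCostEPR hd hε hδ hδ2
  refine ⟨h, le_trans ?_ h⟩
  rw [EReal.coe_le_coe_iff]
  linarith [NonlocalSim.two_mul_logb_succ_le hd]
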